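/- **Setting.** A hyperquiver has vertices $[n]$ and a finite set $E$ of hyperedges; a hyperedge $e$ has an index $\mu(e)\ge 1$ and a tuple of vertices $v(e)=(s_1(e),\dots,s_\mu(e),t(e))$ (sources and target). Fix dimensions $d_i\ge 1$ ($i\in[n]$) and put $\mathbb C^e=\mathbb C^{d_{t(e)}}\otimes\mathbb C^{d_{s_1(e)}}\otimes\cdots\otimes\mathbb C^{d_{s_\mu(e)}}$; for $T\in\mathbb C^e$ let $T(\mathbf x_{s(e)})\in\mathbb C^{d_{t(e)}}$ be its contraction with the vectors at the sources. Let $E=\coprod_{r=1}^M E_r$ be a partition into nonempty classes with representatives $e_r\in E_r$, together with, for every $e\in E_r$, a permutation of tuple positions that carries $v(e)$ to $v(e_r)$ (so $\mu(e)=\mu(e_r)$), is the identity for $e=e_r$, and is such that distinct edges of $E_r$ have their targets carried to distinct positions of $v(e_r)$. For $T\in\mathbb C^{e_r}$ and $e\in E_r$, write $T(\mathbf x_{s(e)})$ for the contraction of the tensor at $e$ obtained from $T$ by this permutation of the modes. Let $X=\prod_{i=1}^n\mathbb P(\mathbb C^{d_i})$ and $F\subseteq E$. The singular vector bundle $\mathscr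 B(\mathbf R,F)=\bigoplus_{e\in E}\mathscr B(e,F)$ over $X$ has at $\chi=([\mathbf x_1],\dots,[\mathbf x_n])$ the summands $$\mathscr B(e,F)_\chi=\operatorname{Hom}\Big(\bigotimes_{j}\operatorname{Span}(\mathbf x_{s_j(e)}),\,V_e\Big),\qquad V_e=\mathbb C^{d_{t(e)}}/\operatorname{Span}(\mathbf x_{t(e)})\ (e\notin F),\qquad V_e=\mathbb C^{d_{t(e)}}\ (e\in F).$$ The linear map $L_F:\bigoplus_{r=1}^M\mathbb C^{e_r}\to\Gamma(\mathscr B(\mathbf R,F))$ sends $(T_r)_r$ to the section whose component at $e\in E_r$ is $\otimes_j\mathbf x_{s_j(e)}\mapsto$ the class of $T_r(\mathbf x_{s(e)})$ in $V_e$. **Almost generated.** Let $\mathscr B$ be a vector bundle on $X$. A subspace $\Lambda\subseteq\Gamma(\mathscr B)$, with $\Lambda(\chi)=\{\sigma(\chi):\sigma\in\Lambda\}$, *almost generates* $\mathscr B$ if either $\Lambda(\chi)=\mathscr B_\chi$ for all $\chi\in X$, or there are $k\ge 1$ smooth irreducible proper closed subvarieties $Y_1,\dots,Y_k$ of $X$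 and, with $Y_0=X$, subbundles $\mathscr B_i\subseteq\mathscr B|_{Y_i}$ ($0\le i\le k$) such that: (i) if $Y_i\subseteq Y_j$, then $\mathscr B_i\subseteq\mathscr B_j|_{Y_i}$; (ii) $\Lambda(\chi)\subseteq(\mathscr B_i)_\chi$ for all $\chi\in Y_i$; (iii) $\Lambda(\chi)=(\mathscr B_i)_\chi$ for all $\chi\in Y_i$ lying on no $Y_j$ ($j\ge1$) that is properly contained in $Y_i$. **Proposition.** Assume that $X$ is not a point (some $d_i\ge 2$) or that every class $E_r$ contains at most one edge of $F$. Then $L_F\big(\bigoplus_{r=1}^M\mathbb C^{e_r}\big)$ almost generates $\mathscr B(\mathbf R,F)$. Moreover, there are an integer $k\ge 0$, $Y_0=X$, $Y_1,\dots,Y_k$ and $\mathscr B_0,\dots,\mathscr B_k$ as above, satisfying (i)–(iii) for $\Lambda=L_F(\bigoplus_r\mathbb C^{e_r})$, such that for every $i$ there is $\alpha\subseteq[n]$ for which $Y_i$ is an irreducible component of $Y_\alpha=\{\chi\in X:\mathbf x_v^\top\mathbf x_v=0\text{ for all }v\in\alpha\}$ (a product of isotropic quadrics and projective spaces), and the fibre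 of $\mathscr B_i$ at $\chi\in Y_i$ consists of all $\tau=(\tau_e)_{e\in E}\in\mathscr B(\mathbf R,F)_\chi$ with $$\mathbf x_{t(e)}^\top\tau_e(\otimes_j\mathbf x_{s_j(e)})=\mathbf x_{t(e')}^\top\tau_{e'}(\otimes_j\mathbf x_{s_j(e')})$$ for all edges $e,e'$ in the same class such that each of them lies in $F$ or has its target in $\alpha$. If every class contains at most one edge of $F$ (for example $F=\varnothing$), then $\mathscr B_0=\mathscr B(\mathbf R,F)$. -/

import Mathlib

open scoped TensorProduct

noncomputable section

namespace SVB

/-! ## Multiprojective space as a classical algebraic variety -/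

/-- The (closed points of the) complex variety `∏ i, ℙ(ℂ^(d i))`.  It is a `def`, so that it does
not inherit a product topology. -/
def MultiProj {n : ℕ} (d : Fin n → ℕ) : Type :=
  ∀ i : Fin n, Projectivization ℂ (Fin (d i) → ℂ)

variable {n : ℕ} {d : Fin n → ℕ}

/-- A vector of homogeneous coordinates of the `i`-th component of `χ`. -/
def MultiProj.vec (χ : MultiProj d) (i : Fin n) : Fin (d i) → ℂ := (χ i).rep

/-- The line in `ℂ^(d i)` which is the `i`-th component of `χ`, that is, the fibre at `χ` of the
pulled back tautological bundle. -/
def MultiProj.line (χ : MultiProj d) (i : Fin n) : Submodule ℂ (Fin (d i) → ℂ) := (χ i).submodule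

/-- The multihomogeneous coordinate ring of `∏ i, ℙ(ℂ^(d i))`. -/
abbrev CoordRing {n : ℕ} (d : Fin n → ℕ) : Type := MvPolynomial (Σ i : Fin n, Fin (d i)) ℂ

/-- `P` is multihomogeneous of multidegree `m`. -/
def IsMultiHom (P : CoordRing d) (m : Fin n → ℕ) : Prop :=
  MvPolynomial.IsWeightedHomogeneous
    (fun v : (Σ i : Fin n, Fin (d i)) => (Pi.single v.1 1 : Fin n → ℕ)) P m

/-- The value of `P` at homogeneous coordinates of `χ`. -/
def evalAt (χ : MultiProj d) (P : CoordRing d) : ℂ :=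
  MvPolynomial.eval (fun v : (Σ i : Fin n, Fin (d i)) => χ.vec v.1 v.2) P

/-- The Zariski topology: the sets where a multihomogeneous polynomial does not vanish form
a basis. -/
instance zariskiTopology (d : Fin n → ℕ) : TopologicalSpace (MultiProj d) :=
  TopologicalSpace.generateFrom
    {U | ∃ (P : CoordRing d) (m : Fin n → ℕ), IsMultiHom P m ∧ U = {χ | evalAt χ P ≠ 0}}

/-- A function on `S` is regular if locally on `S` it is a quotient of two multihomogeneous
polynomials of the same multidegree. -/
def IsRegularOn (S : Set (MultiProj d)) (f : MultiProj d → ℂ) : Prop :=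
  ∀ χ ∈ S, ∃ (P Q : CoordRing d) (m : Fin n → ℕ), IsMultiHom P m ∧ IsMultiHom Q m ∧
    evalAt χ Q ≠ 0 ∧ ∀ ψ ∈ S, evalAt ψ Q ≠ 0 → f ψ = evalAt ψ P / evalAt ψ Q

/-- Smoothness of a closed set `Y`, by the Jacobian criterion: near each of its points, `Y` is the
zero locus of finitely many multihomogeneous polynomials whose differentials at this point are
linearly independent. -/
def IsSmooth (Y : Set (MultiProj d)) : Prop :=
  ∀ χ ∈ Y, ∃ (U : Set (MultiProj d)) (r : ℕ) (P : Fin r → CoordRing d),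
    IsOpen U ∧ χ ∈ U ∧ (∀ a, ∃ m, IsMultiHom (P a) m) ∧
    (∀ ψ ∈ U, ψ ∈ Y ↔ ∀ a, evalAt ψ (P a) = 0) ∧
    LinearIndependent ℂ (fun (a : Fin r) (v : Σ i : Fin n, Fin (d i)) =>
      evalAt χ (MvPolynomial.pderiv v (P a)))

/-- A smooth irreducible proper closed subvariety of `∏ i, ℙ(ℂ^(d i))`. -/
structure IsSmoothIrredProper (Y : Set (MultiProj d)) : Prop where
  closed : IsClosed Y
  irreducible : IsIrreducible Y
  smooth : IsSmooth Y
  proper : Y ≠ Set.univ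

/-! ## Algebraic vector bundles and almost generation -/

/-- An algebraic vector bundle on `∏ i, ℙ(ℂ^(d i))`: a family of vector spaces with an atlas of
local trivializations `triv c` on Zariski open sets `dom c` (outside `dom c` the value of `triv c`
is irrelevant), whose transition matrices are regular. -/
structure VBundle {n : ℕ} (d : Fin n → ℕ) where
  Fib : MultiProj d → Type
  [addCommGroup : ∀ χ, AddCommGroup (Fib χ)]
  [module : ∀ χ, Module ℂ (Fib χ)]
  Chart : Type
  dom : Chart → Set (MultiProj d)
  isOpen_dom : ∀ c, IsOpen (dom c)
  cover : ∀ χ, ∃ c, χ ∈ dom c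
  Coord : Chart → Type
  [fintypeCoord : ∀ c, Fintype (Coord c)]
  triv : ∀ (c : Chart) (χ : MultiProj d), Fib χ →ₗ[ℂ] (Coord c → ℂ)
  triv_bijective : ∀ c, ∀ χ ∈ dom c, Function.Bijective (triv c χ)
  transition : ∀ c c' : Chart, ∃ g : Coord c' → Coord c → MultiProj d → ℂ,
    (∀ k l, IsRegularOn (dom c ∩ dom c') (g k l)) ∧
    ∀ χ ∈ dom c ∩ dom c', ∀ (w : Fib χ) (k : Coord c'),
      triv c' χ w k = ∑ l, g k l χ * triv c χ w l

attribute [instance] VBundle.addCommGroup VBundle.module VBundle.fintypeCoord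

namespace VBundle

variable (B : VBundle d)

/-- `s` restricts to a regular section over `S` of the restriction of `B` to `S`. -/
def IsRegularSection (S : Set (MultiProj d)) (s : ∀ χ, B.Fib χ) : Prop :=
  ∀ (c : B.Chart) (k : B.Coord c), IsRegularOn (S ∩ B.dom c) (fun χ => B.triv c χ (s χ) k)

/-- The fibres `W χ`, for `χ ∈ Y`, form an algebraic subbundle of the restriction of `B` to `Y`:
locally on `Y` they have a basis of regular sections of `B`, linearly independent in each fibre.
The values of `W` outside `Y` are irrelevant. -/
def IsSubbundle (Y : Set (MultiProj d)) (W : ∀ χ, Submodule ℂ (B.Fib χ)) : Prop :=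
  ∀ χ ∈ Y, ∃ (U : Set (MultiProj d)) (r : ℕ) (s : Fin r → ∀ ψ, B.Fib ψ),
    IsOpen U ∧ χ ∈ U ∧ (∀ a, B.IsRegularSection (Y ∩ U) (s a)) ∧
    ∀ ψ ∈ Y ∩ U, LinearIndependent ℂ (fun a => s a ψ) ∧
      Submodule.span ℂ (Set.range fun a => s a ψ) = W ψ

/-- `Λ(χ)`: the values at `χ` of the sections in `Λ`. -/
def values (Λ : Submodule ℂ (∀ χ, B.Fib χ)) (χ : MultiProj d) : Submodule ℂ (B.Fib χ) :=
  Λ.map (LinearMap.proj χ)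

/-- `Λ` generates `B` globally. -/
def Generates (Λ : Submodule ℂ (∀ χ, B.Fib χ)) : Prop := ∀ χ, B.values Λ χ = ⊤

/-- The subvarieties `Y 0 = X, Y 1, …, Y k` and the bundles over them with fibres `W i χ`
exhibit `Λ` as almost generating `B`. -/
structure IsStratification (Λ : Submodule ℂ (∀ χ, B.Fib χ)) (k : ℕ)
    (Y : Fin (k + 1) → Set (MultiProj d))
    (W : Fin (k + 1) → ∀ χ, Submodule ℂ (B.Fib χ)) : Prop where
  zero : Y 0 = Set.univ
  variety : ∀ i, i ≠ 0 → IsSmoothIrredProper (Y i)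
  bundle : ∀ i, B.IsSubbundle (Y i) (W i)
  mono : ∀ i j, Y i ⊆ Y j → ∀ χ ∈ Y i, W i χ ≤ W j χ
  values_le : ∀ i, ∀ χ ∈ Y i, B.values Λ χ ≤ W i χ
  values_eq : ∀ i, ∀ χ ∈ Y i, (∀ j, j ≠ 0 → Y j ⊂ Y i → χ ∉ Y j) → B.values Λ χ = W i χ

/-- The vector space `Λ` consists of global regular sections of `B` and almost generates `B`. -/
def AlmostGenerates (Λ : Submodule ℂ (∀ χ, B.Fib χ)) : Prop :=
  (∀ s ∈ Λ, B.IsRegularSection Set.univ s) ∧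
  (B.Generates Λ ∨
    ∃ k : ℕ, 1 ≤ k ∧ ∃ (Y : Fin (k + 1) → Set (MultiProj d))
      (W : Fin (k + 1) → ∀ χ, Submodule ℂ (B.Fib χ)), B.IsStratification Λ k Y W)

end VBundle

/-! ### Regular functions: closure properties and the affine charts -/

section regular

variable {S : Set (MultiProj d)} {f g : MultiProj d → ℂ}

theorem evalAt_mul (χ : MultiProj d) (P Q : CoordRing d) :
    evalAt χ (P * Q) = evalAt χ P * evalAt χ Q := by simp [evalAt]

theorem IsRegularOn.const (a : ℂ) : IsRegularOn S (fun _ => a) := fun χ _ =>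
  ⟨MvPolynomial.C a, 1, 0, MvPolynomial.isWeightedHomogeneous_C _ a,
    MvPolynomial.isWeightedHomogeneous_one ℂ _, by simp [evalAt],
    fun ψ _ _ => by simp [evalAt]⟩

theorem IsRegularOn.mul (hf : IsRegularOn S f) (hg : IsRegularOn S g) :
    IsRegularOn S (fun χ => f χ * g χ) := by
  intro χ hχ
  obtain ⟨P, Q, m, hP, hQ, h0, h⟩ := hf χ hχ
  obtain ⟨P', Q', m', hP', hQ', h0', h'⟩ := hg χ hχ
  refine ⟨P * P', Q * Q', m + m', hP.mul hP', hQ.mul hQ', ?_, ?_⟩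
  · rw [evalAt_mul]; exact mul_ne_zero h0 h0'
  · intro ψ hψ h1
    rw [evalAt_mul] at h1
    beta_reduce
    rw [h ψ hψ (left_ne_zero_of_mul h1), h' ψ hψ (right_ne_zero_of_mul h1), evalAt_mul, evalAt_mul,
      div_mul_div_comm]

theorem IsRegularOn.sub (hf : IsRegularOn S f) (hg : IsRegularOn S g) :
    IsRegularOn S (fun χ => f χ - g χ) := by
  intro χ hχ
  obtain ⟨P, Q, m, hP, hQ, h0, h⟩ := hf χ hχ
  obtain ⟨P', Q', m', hP', hQ', h0', h'⟩ := hg χ hχ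
  refine ⟨P * Q' - Q * P', Q * Q', m + m', (hP.mul hQ').sub (hQ.mul hP'), hQ.mul hQ', ?_, ?_⟩
  · rw [evalAt_mul]; exact mul_ne_zero h0 h0'
  · intro ψ hψ h1
    rw [evalAt_mul] at h1
    have e : evalAt ψ (P * Q' - Q * P') =
        evalAt ψ P * evalAt ψ Q' - evalAt ψ Q * evalAt ψ P' := by simp [evalAt]
    beta_reduce
    rw [h ψ hψ (left_ne_zero_of_mul h1), h' ψ hψ (right_ne_zero_of_mul h1), evalAt_mul, e,
      div_sub_div _ _ (left_ne_zero_of_mul h1) (right_ne_zero_of_mul h1)]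

theorem IsRegularOn.prod {ι : Type*} (s : Finset ι) {f : ι → MultiProj d → ℂ}
    (hf : ∀ i ∈ s, IsRegularOn S (f i)) : IsRegularOn S (fun χ => ∏ i ∈ s, f i χ) := by
  classical
  induction s using Finset.induction_on with
  | empty => simpa using IsRegularOn.const (S := S) 1
  | insert a s ha ih =>
    simp only [Finset.prod_insert ha]
    exact (hf a (by simp)).mul (ih fun i hi => hf i (by simp [hi]))

end regular

theorem MultiProj.vec_ne_zero (χ : MultiProj d) (i : Fin n) : χ.vec i ≠ 0 :=
  Projectivization.rep_nonzero _

theorem MultiProj.line_eq (χ : MultiProj d) (i : Fin n) :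
    χ.line i = Submodule.span ℂ {χ.vec i} := Projectivization.submodule_eq _

theorem MultiProj.vec_mem (χ : MultiProj d) (i : Fin n) : χ.vec i ∈ χ.line i := by
  rw [χ.line_eq]; exact Submodule.mem_span_singleton_self _

/-- The standard affine chart of `∏ i, ℙ(ℂ^(d i))` where the coordinates chosen by `c` do not
vanish. -/
def chartDom (c : ∀ i : Fin n, Fin (d i)) : Set (MultiProj d) := {χ | ∀ i, χ.vec i (c i) ≠ 0}

/-- The representative of the `i`-th component of `χ` whose coordinate chosen by `c` is `1`. -/
def unitVec (c : ∀ i : Fin n, Fin (d i)) (χ : MultiProj d) (i : Fin n) : χ.line i :=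
  (χ.vec i (c i))⁻¹ • ⟨χ.vec i, χ.vec_mem i⟩

theorem unitVec_apply (c : ∀ i : Fin n, Fin (d i)) (χ : MultiProj d) (i : Fin n) (k : Fin (d i)) :
    (unitVec c χ i : Fin (d i) → ℂ) k = (χ.vec i (c i))⁻¹ * χ.vec i k := rfl

theorem isMultiHom_X (i : Fin n) (k : Fin (d i)) :
    IsMultiHom (MvPolynomial.X ⟨i, k⟩ : CoordRing d) (Pi.single i 1) :=
  MvPolynomial.isWeightedHomogeneous_X ℂ _ _

theorem evalAt_X (χ : MultiProj d) (i : Fin n) (k : Fin (d i)) :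
    evalAt χ (MvPolynomial.X ⟨i, k⟩ : CoordRing d) = χ.vec i k := by simp [evalAt]

theorem isOpen_chartDom (c : ∀ i : Fin n, Fin (d i)) : IsOpen (chartDom c) := by
  have : chartDom c = ⋂ i, {χ | evalAt χ (MvPolynomial.X ⟨i, c i⟩ : CoordRing d) ≠ 0} := by
    ext χ; simp [chartDom, evalAt_X]
  rw [this]
  exact isOpen_iInter_of_finite fun i =>
    TopologicalSpace.isOpen_generateFrom_of_mem ⟨_, _, isMultiHom_X i (c i), rfl⟩

theorem chartDom_cover (χ : MultiProj d) : ∃ c, χ ∈ chartDom c := by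
  have h : ∀ i, ∃ k, χ.vec i k ≠ 0 := fun i => Function.ne_iff.mp (χ.vec_ne_zero i)
  choose c hc using h
  exact ⟨c, hc⟩

theorem isRegularOn_ratio {S : Set (MultiProj d)} (i : Fin n) (k l : Fin (d i))
    (hS : ∀ χ ∈ S, χ.vec i l ≠ 0) :
    IsRegularOn S (fun χ => χ.vec i k / χ.vec i l) := fun χ hχ =>
  ⟨_, _, _, isMultiHom_X i k, isMultiHom_X i l, by rw [evalAt_X]; exact hS χ hχ,
    fun ψ _ _ => by rw [evalAt_X, evalAt_X]⟩

/-! ## Hyperquivers -/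

/-- A hyperquiver with vertices `Fin n` and hyperedges `Fin q`.  The hyperedge `e` has the tuple of
vertices `vert e` of length `index e + 1`; the last one is its target, the others its sources. -/
structure Hyperquiver (n q : ℕ) where
  index : Fin q → ℕ
  one_le_index : ∀ e, 1 ≤ index e
  vert : ∀ e, Fin (index e + 1) → Fin n

variable {q : ℕ}

namespace Hyperquiver

variable (H : Hyperquiver n q)

def src (e : Fin q) (j : Fin (H.index e)) : Fin n := H.vert e j.castSucc

def tgt (e : Fin q) : Fin n := H.vert e (Fin.last _)

/-- A partition of the hyperedges into nonempty classes `0, …, M - 1`, with a representative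
`rep r` of each class.  The tuple of vertices of `e` is obtained from the one of the representative
`rep (cls e)` by the permutation `perm e`: position `j` of `e` corresponds to position `perm e j`
of the representative.  Distinct hyperedges of one class have their targets at distinct positions
of the representative. -/
structure Partition where
  M : ℕ
  cls : Fin q → Fin M
  rep : Fin M → Fin q
  cls_rep : ∀ r, cls (rep r) = r
  perm : ∀ e, Fin (H.index e + 1) ≃ Fin (H.index (rep (cls e)) + 1)
  vert_perm : ∀ e j, H.vert (rep (cls e)) (perm e j) = H.vert e j
  perm_rep : ∀ r j, (perm (rep r) j : ℕ) = j
  perm_last_inj : ∀ e e', cls e = cls e' →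
    (perm e (Fin.last _) : ℕ) = perm e' (Fin.last _) → e = e'

/-- The space `ℂ^e` of tensors of the format prescribed by `e`, as arrays of coordinates; the last
index belongs to the target. -/
abbrev Tensor (d : Fin n → ℕ) (e : Fin q) : Type :=
  (∀ j : Fin (H.index e + 1), Fin (d (H.vert e j))) → ℂ

/-- The vector `T(x_{s(e)})` with coordinates
`∑ T(i_1, …, i_μ, l) x_{s_1(e)}(i_1) ⋯ x_{s_μ(e)}(i_μ)`, as a multilinear map in the vectors at the
sources. -/
def contract (e : Fin q) (T : H.Tensor d e) :
    MultilinearMap ℂ (fun j : Fin (H.index e) => Fin (d (H.src e j)) → ℂ)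
      (Fin (d (H.tgt e)) → ℂ) :=
  MultilinearMap.pi fun l =>
    ∑ i : (∀ j : Fin (H.index e), Fin (d (H.src e j))),
      T (Fin.snoc (α := fun j => Fin (d (H.vert e j))) i l) •
        (MultilinearMap.mkPiAlgebra ℂ (Fin (H.index e)) ℂ).compLinearMap
          (fun j => LinearMap.proj (i j))

theorem contract_apply (e : Fin q) (T : H.Tensor d e) (x : ∀ j, Fin (d (H.src e j)) → ℂ)
    (l : Fin (d (H.tgt e))) :
    H.contract e T x l = ∑ i : (∀ j : Fin (H.index e), Fin (d (H.src e j))),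
      T (Fin.snoc (α := fun j => Fin (d (H.vert e j))) i l) * ∏ j, x j (i j) := by
  simp [contract]

variable {H}

/-- The tensor at the hyperedge `e` which agrees up to the permutation `perm e` with the tensor `T`
at the representative of the class of `e`. -/
def Partition.permute (P : H.Partition) (e : Fin q) (T : H.Tensor d (P.rep (P.cls e))) :
    H.Tensor d e :=
  fun i => T fun j => Fin.cast
    (congrArg d (by rw [← P.vert_perm e, Equiv.apply_symm_apply])) (i ((P.perm e).symm j))

variable (H)

/-! ## The singular vector bundle -/

section bundle

variable (F : Finset (Fin q))

/-- The subspace of `ℂ^(d (tgt e))` which is divided out in the fibre at `χ`: it is the line of the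
target if `e ∉ F`, and `0` if `e ∈ F`. -/
def relations (χ : MultiProj d) (e : Fin q) : Submodule ℂ (Fin (d (H.tgt e)) → ℂ) :=
  if e ∈ F then ⊥ else χ.line (H.tgt e)

/-- The fibre `⨂ j, Span(x_{s_j(e)})` of the bundle `𝒯(e)` at `χ`. -/
abbrev SourceFib (χ : MultiProj d) (e : Fin q) : Type :=
  ⨂[ℂ] j : Fin (H.index e), χ.line (H.src e j)

/-- The fibre of `ℬ(e, F)` at `χ`: linear maps from `⨂ j, Span(x_{s_j(e)})` to
`ℂ^(d (tgt e)) / Span(x_{t(e)})` if `e ∉ F`, and to `ℂ^(d (tgt e)) = ℂ^(d (tgt e)) / 0`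
if `e ∈ F`. -/
abbrev EdgeFib (χ : MultiProj d) (e : Fin q) : Type :=
  H.SourceFib χ e →ₗ[ℂ] ((Fin (d (H.tgt e)) → ℂ) ⧸ H.relations F χ e)

/-- The local coordinates of a fibre in the chart `c`: all coordinates of the target vector if
`e ∈ F`, and all but the one chosen by `c` if `e ∉ F`. -/
abbrev FibCoord (c : ∀ i : Fin n, Fin (d i)) : Type :=
  Σ e : Fin q, {k : Fin (d (H.tgt e)) // e ∈ F ∨ k ≠ c (H.tgt e)}

/-- The linear form on `ℂ^(d (tgt e))` which is `y ↦ y k` if `e ∈ F`, and otherwise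
`y ↦ y k - y c * (x k / x c)`, where `x` spans the line of the target and `x c ≠ 0`. -/
def coordForm (c : ∀ i : Fin n, Fin (d i)) (χ : MultiProj d) (e : Fin q) (k : Fin (d (H.tgt e))) :
    (Fin (d (H.tgt e)) → ℂ) →ₗ[ℂ] ℂ :=
  if e ∈ F then LinearMap.proj k
  else (χ.vec (H.tgt e) (c (H.tgt e)))⁻¹ •
    (χ.vec (H.tgt e) (c (H.tgt e)) • LinearMap.proj k
      - χ.vec (H.tgt e) k • LinearMap.proj (c (H.tgt e)))

theorem relations_le_ker (c : ∀ i : Fin n, Fin (d i)) (χ : MultiProj d) (e : Fin q)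
    (k : Fin (d (H.tgt e))) : H.relations F χ e ≤ LinearMap.ker (H.coordForm F c χ e k) := by
  by_cases he : e ∈ F
  · simp [relations, he]
  · rw [relations, if_neg he, χ.line_eq, Submodule.span_singleton_le_iff_mem, LinearMap.mem_ker]
    simp only [coordForm, if_neg he, LinearMap.smul_apply, LinearMap.sub_apply,
      LinearMap.proj_apply, smul_eq_mul]
    ring

/-- The trivialization of `ℬ(R, F)` over the affine chart `c`: evaluate at the tensor product of the
normalized representatives, then take coordinates. -/
def trivMap (c : ∀ i : Fin n, Fin (d i)) (χ : MultiProj d) :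
    (∀ e, H.EdgeFib F χ e) →ₗ[ℂ] (H.FibCoord F c → ℂ) :=
  LinearMap.pi fun k =>
    ((H.relations F χ k.1).liftQ (H.coordForm F c χ k.1 k.2.1) (H.relations_le_ker F c χ k.1 k.2.1)
      ∘ₗ LinearMap.applyₗ (PiTensorProduct.tprod ℂ fun j => unitVec c χ (H.src k.1 j)))
      ∘ₗ LinearMap.proj k.1

variable {H F}

theorem trivMap_apply (c : ∀ i : Fin n, Fin (d i)) (χ : MultiProj d) (φ : ∀ e, H.EdgeFib F χ e)
    (k : H.FibCoord F c) (y : Fin (d (H.tgt k.1)) → ℂ)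
    (hy : φ k.1 (PiTensorProduct.tprod ℂ fun j => unitVec c χ (H.src k.1 j)) =
      (H.relations F χ k.1).mkQ y) :
    H.trivMap F c χ φ k = H.coordForm F c χ k.1 k.2.1 y := by
  simp only [trivMap, LinearMap.pi_apply, LinearMap.comp_apply, LinearMap.proj_apply,
    LinearMap.applyₗ_apply_apply, hy]
  exact Submodule.liftQ_apply _ _ _

theorem line_smul {c : ∀ i : Fin n, Fin (d i)} {χ : MultiProj d} (hχ : χ ∈ chartDom c) (i : Fin n)
    (v : χ.line i) : v = (v : Fin (d i) → ℂ) (c i) • unitVec c χ i := by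
  obtain ⟨v, hv⟩ := v
  have hv' := hv
  rw [χ.line_eq, Submodule.mem_span_singleton] at hv'
  obtain ⟨a, rfl⟩ := hv'
  ext k
  have := hχ i
  simp only [Submodule.coe_smul, Pi.smul_apply, smul_eq_mul, unitVec_apply]
  field_simp

theorem map_tprod {c : ∀ i : Fin n, Fin (d i)} {χ : MultiProj d} (hχ : χ ∈ chartDom c) {e : Fin q}
    {M : Type*} [AddCommGroup M] [Module ℂ M] (φ : H.SourceFib χ e →ₗ[ℂ] M)
    (v : ∀ j, χ.line (H.src e j)) :
    φ (PiTensorProduct.tprod ℂ v) =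
      (∏ j, (v j : Fin (d (H.src e j)) → ℂ) (c (H.src e j))) •
        φ (PiTensorProduct.tprod ℂ fun j => unitVec c χ (H.src e j)) := by
  rw [← map_smul, ← MultilinearMap.map_smul_univ]
  congr 2
  funext j
  exact line_smul hχ _ (v j)

theorem coordForm_eq_zero {c : ∀ i : Fin n, Fin (d i)} {χ : MultiProj d} (hχ : χ ∈ chartDom c)
    (e : Fin q) (y : Fin (d (H.tgt e)) → ℂ)
    (hy : ∀ k : Fin (d (H.tgt e)), (e ∈ F ∨ k ≠ c (H.tgt e)) → H.coordForm F c χ e k y = 0) :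
    y ∈ H.relations F χ e := by
  by_cases he : e ∈ F
  · rw [relations, if_pos he, Submodule.mem_bot]
    funext k
    simpa [coordForm, he] using hy k (Or.inl he)
  · rw [relations, if_neg he, χ.line_eq, Submodule.mem_span_singleton]
    have hc := hχ (H.tgt e)
    refine ⟨y (c (H.tgt e)) / χ.vec (H.tgt e) (c (H.tgt e)), ?_⟩
    funext k
    by_cases hk : k = c (H.tgt e)
    · subst hk
      simp [hc]
    · have := hy k (Or.inr hk)
      simp only [coordForm, if_neg he, LinearMap.smul_apply, LinearMap.sub_apply,
        LinearMap.proj_apply, smul_eq_mul, mul_eq_zero, inv_eq_zero, hc, false_or] at this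
      simp only [Pi.smul_apply, smul_eq_mul]
      field_simp
      linear_combination -this

theorem coordForm_extend {c : ∀ i : Fin n, Fin (d i)} {χ : MultiProj d} (hχ : χ ∈ chartDom c)
    (v : H.FibCoord F c → ℂ) (k : H.FibCoord F c) :
    H.coordForm F c χ k.1 k.2.1
      (fun l => if h : k.1 ∈ F ∨ l ≠ c (H.tgt k.1) then v ⟨k.1, l, h⟩ else 0) = v k := by
  obtain ⟨e, k, hk⟩ := k
  have hc := hχ (H.tgt e)
  by_cases he : e ∈ F
  · simp [coordForm, he]
  · have hk' : k ≠ c (H.tgt e) := hk.resolve_left he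
    simp [coordForm, he, hk', hc]

theorem trivMap_bijective {c : ∀ i : Fin n, Fin (d i)} {χ : MultiProj d} (hχ : χ ∈ chartDom c) :
    Function.Bijective (H.trivMap F c χ) := by
  constructor
  · rw [injective_iff_map_eq_zero]
    intro φ hφ
    funext e
    obtain ⟨y, hy⟩ := (H.relations F χ e).mkQ_surjective
      (φ e (PiTensorProduct.tprod ℂ fun j => unitVec c χ (H.src e j)))
    have h0 : y ∈ H.relations F χ e := coordForm_eq_zero hχ e y fun k hk => by
      rw [← trivMap_apply c χ φ ⟨e, k, hk⟩ y hy.symm, hφ]; rfl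
    apply PiTensorProduct.ext
    ext v : 1
    simp only [LinearMap.compMultilinearMap_apply]
    rw [map_tprod hχ, ← hy, Submodule.mkQ_apply, (Submodule.Quotient.mk_eq_zero _).mpr h0]
    simp
  · intro v
    refine ⟨fun e => (PiTensorProduct.lift
      ((MultilinearMap.mkPiAlgebra ℂ (Fin (H.index e)) ℂ).compLinearMap fun j =>
        (LinearMap.proj (c (H.src e j))) ∘ₗ (χ.line (H.src e j)).subtype)).smulRight
      ((H.relations F χ e).mkQ
        (fun l => if h : e ∈ F ∨ l ≠ c (H.tgt e) then v ⟨e, l, h⟩ else 0)), ?_⟩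
    funext k
    rw [trivMap_apply c χ _ k
      (fun l => if h : k.1 ∈ F ∨ l ≠ c (H.tgt k.1) then v ⟨k.1, l, h⟩ else 0)]
    · exact coordForm_extend hχ v k
    · have : ∀ j, (χ.vec (H.src k.1 j) (c (H.src k.1 j)))⁻¹ *
          χ.vec (H.src k.1 j) (c (H.src k.1 j)) = 1 := fun j => inv_mul_cancel₀ (hχ _)
      simp [unitVec_apply, this]

/-- The transition matrix from the chart `c` to the chart `c'`. -/
def transMat (c c' : ∀ i : Fin n, Fin (d i)) (k : H.FibCoord F c') (l : H.FibCoord F c)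
    (χ : MultiProj d) : ℂ :=
  (if k.1 = l.1 then 1 else 0) *
  ((∏ j, χ.vec (H.src k.1 j) (c (H.src k.1 j)) / χ.vec (H.src k.1 j) (c' (H.src k.1 j))) *
    ((if (l.2.1 : ℕ) = k.2.1 then 1 else 0) -
      (if k.1 ∉ F ∧ (l.2.1 : ℕ) = c' (H.tgt k.1) then 1 else 0) *
        (χ.vec (H.tgt k.1) k.2.1 / χ.vec (H.tgt k.1) (c' (H.tgt k.1)))))

theorem transMat_regular (c c' : ∀ i : Fin n, Fin (d i)) (k : H.FibCoord F c')
    (l : H.FibCoord F c) : IsRegularOn (chartDom c ∩ chartDom c') (transMat c c' k l) :=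
  (IsRegularOn.const _).mul ((IsRegularOn.prod _ fun _ _ =>
    isRegularOn_ratio _ _ _ fun _ hχ => hχ.2 _).mul
      ((IsRegularOn.const _).sub ((IsRegularOn.const _).mul
        (isRegularOn_ratio _ _ _ fun _ hχ => hχ.2 _))))

theorem transMat_spec (c c' : ∀ i : Fin n, Fin (d i)) {χ : MultiProj d}
    (hχ : χ ∈ chartDom c ∩ chartDom c') (φ : ∀ e, H.EdgeFib F χ e) (k : H.FibCoord F c') :
    H.trivMap F c' χ φ k = ∑ l, transMat c c' k l χ * H.trivMap F c χ φ l := by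
  set v := H.trivMap F c χ φ with hv
  obtain ⟨e, k, hk⟩ := k
  set w : Fin (d (H.tgt e)) → ℂ :=
    fun l => if h : e ∈ F ∨ l ≠ c (H.tgt e) then v ⟨e, l, h⟩ else 0 with hw
  set a : ℂ := ∏ j, χ.vec (H.src e j) (c (H.src e j)) / χ.vec (H.src e j) (c' (H.src e j)) with ha
  -- the value of `φ e` at the normalized tensor of the chart `c` is the class of `w`
  have h1 : φ e (PiTensorProduct.tprod ℂ fun j => unitVec c χ (H.src e j)) =
      (H.relations F χ e).mkQ w := by
    obtain ⟨y, hy⟩ := (H.relations F χ e).mkQ_surjective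
      (φ e (PiTensorProduct.tprod ℂ fun j => unitVec c χ (H.src e j)))
    rw [← hy, ← sub_eq_zero, ← map_sub, Submodule.mkQ_apply, Submodule.Quotient.mk_eq_zero]
    refine coordForm_eq_zero hχ.1 e _ fun l hl => ?_
    rw [map_sub, ← trivMap_apply c χ φ ⟨e, l, hl⟩ y hy.symm, coordForm_extend hχ.1 v ⟨e, l, hl⟩,
      ← hv, sub_self]
  have h2 : φ e (PiTensorProduct.tprod ℂ fun j => unitVec c' χ (H.src e j)) =
      (H.relations F χ e).mkQ (a • w) := by
    rw [map_tprod hχ.1, h1, map_smul]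
    congr 1
    exact Finset.prod_congr rfl fun j _ => by rw [unitVec_apply, div_eq_inv_mul]
  rw [trivMap_apply c' χ φ ⟨e, k, hk⟩ _ h2, map_smul, smul_eq_mul]
  have h3 : ∀ m : Fin (d (H.tgt e)),
      ∑ l : {l : Fin (d (H.tgt e)) // e ∈ F ∨ l ≠ c (H.tgt e)},
        (if (l.1 : ℕ) = m then (1 : ℂ) else 0) * v ⟨e, l⟩ = w m := by
    intro m
    by_cases hm : e ∈ F ∨ m ≠ c (H.tgt e)
    · rw [Finset.sum_eq_single ⟨m, hm⟩]
      · simp [hw, hm]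
      · intro b _ hb
        rw [if_neg, zero_mul]
        intro h
        exact hb (Subtype.ext (Fin.ext h))
      · simp
    · rw [Finset.sum_eq_zero]
      · simp [hw, hm]
      · intro l _
        rw [if_neg, zero_mul]
        intro h
        exact hm (Fin.ext h ▸ l.2)
  rw [Fintype.sum_sigma, Finset.sum_eq_single e]
  · have h4 : ∀ l : {l : Fin (d (H.tgt e)) // e ∈ F ∨ l ≠ c (H.tgt e)},
        transMat (H := H) (F := F) c c' ⟨e, k, hk⟩ ⟨e, l⟩ χ * v ⟨e, l⟩ =
        a * ((if (l.1 : ℕ) = k then (1 : ℂ) else 0) * v ⟨e, l⟩ - (if e ∈ F then 0 else 1) *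
          (χ.vec (H.tgt e) k / χ.vec (H.tgt e) (c' (H.tgt e))) *
            ((if (l.1 : ℕ) = c' (H.tgt e) then (1 : ℂ) else 0) * v ⟨e, l⟩)) := by
      intro l
      by_cases he : e ∈ F <;> simp [transMat, he, ha] <;> split_ifs <;> ring
    rw [Finset.sum_congr rfl fun l _ => h4 l, ← Finset.mul_sum, Finset.sum_sub_distrib,
      ← Finset.mul_sum, h3, h3]
    congr 1
    have hc := hχ.2 (H.tgt e)
    by_cases he : e ∈ F
    · simp [coordForm, he]
    · simp only [coordForm, if_neg he, LinearMap.smul_apply, LinearMap.sub_apply,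
        LinearMap.proj_apply, smul_eq_mul]
      field_simp
  · intro e' _ he'
    refine Finset.sum_eq_zero fun l _ => ?_
    simp [transMat, Ne.symm he']
  · simp

variable (H F)

/-- The singular vector bundle `ℬ(R, F) = ⨁ e, ℬ(e, F)` with respect to the set `F` of hyperedges,
for the dimension vector `d`. -/
def singularVectorBundle (d : Fin n → ℕ) : VBundle d where
  Fib χ := ∀ e, H.EdgeFib F χ e
  Chart := ∀ i, Fin (d i)
  dom := chartDom
  isOpen_dom := isOpen_chartDom
  cover := chartDom_cover
  Coord c := H.FibCoord F c
  triv c χ := H.trivMap F c χ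
  triv_bijective _ _ hχ := trivMap_bijective hχ
  transition c c' := ⟨transMat c c', transMat_regular c c', fun _ hχ φ k =>
    transMat_spec c c' hχ φ k⟩

variable {H}

/-- The map `L_F`: the component at `χ` and `e` of the image of `(T_r)` is the linear map which
sends `⨂ x_{s_j(e)}` to the class of the vector `T(x_{s(e)})`, where `T` is the tensor at `e` which
agrees up to permutation with the tensor `T_r` of the class of `e`. -/
def sectionMap (P : H.Partition) (d : Fin n → ℕ) :
    (∀ r : Fin P.M, H.Tensor d (P.rep r)) →ₗ[ℂ] (∀ χ, (H.singularVectorBundle F d).Fib χ) where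
  toFun T χ e := (H.relations F χ e).mkQ ∘ₗ PiTensorProduct.lift
    ((H.contract e (P.permute e (T (P.cls e)))).compLinearMap
      fun j => (χ.line (H.src e j)).subtype)
  map_add' T T' := by
    funext χ e
    have : H.contract e (P.permute e ((T + T') (P.cls e))) =
        H.contract e (P.permute e (T (P.cls e))) + H.contract e (P.permute e (T' (P.cls e))) := by
      ext x l
      simp [contract_apply, Partition.permute, add_mul, Finset.sum_add_distrib]
    change (H.relations F χ e).mkQ ∘ₗ PiTensorProduct.lift _ =
      (H.relations F χ e).mkQ ∘ₗ PiTensorProduct.lift _ +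
      (H.relations F χ e).mkQ ∘ₗ PiTensorProduct.lift _
    rw [this, ← LinearMap.comp_add, ← map_add]
    rfl
  map_smul' a T := by
    funext χ e
    have : H.contract e (P.permute e ((a • T) (P.cls e))) =
        a • H.contract e (P.permute e (T (P.cls e))) := by
      ext x l
      simp [contract_apply, Partition.permute, Finset.mul_sum, mul_assoc]
    change (H.relations F χ e).mkQ ∘ₗ PiTensorProduct.lift _ =
      a • (H.relations F χ e).mkQ ∘ₗ PiTensorProduct.lift _
    rw [this, ← LinearMap.comp_smul, ← map_smul]
    rfl

/-! ## Products of isotropic quadrics and equal contractions -/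

/-- The product of the isotropic quadrics `x ⬝ x = 0` at the vertices in `α` and of the full
projective spaces at the other vertices. -/
def _root_.SVB.isotropicLocus (d : Fin n → ℕ) (α : Set (Fin n)) : Set (MultiProj d) :=
  {χ | ∀ i ∈ α, χ.vec i ⬝ᵥ χ.vec i = 0}

/-- For `τ` in the fibre of `ℬ(R, F)` at `χ`: for all hyperedges `e`, `e'` of the same class,
each of them in `F` or with target in `α`, the contractions of `τ e (⨂ x_{s_j(e)})` with `x_{t(e)}`
and of `τ e' (⨂ x_{s_j(e')})` with `x_{t(e')}` are equal.  Here `x` are any representatives of `χ`,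
and `y`, `y'` are any vectors representing the values of `τ e`, `τ e'`. -/
def EqualContractions (P : H.Partition) (α : Set (Fin n)) (χ : MultiProj d)
    (τ : (H.singularVectorBundle F d).Fib χ) : Prop :=
  ∀ e e' : Fin q, P.cls e = P.cls e' → (e ∈ F ∨ H.tgt e ∈ α) → (e' ∈ F ∨ H.tgt e' ∈ α) →
    ∀ x : ∀ i, χ.line i, (∀ i, x i ≠ 0) →
    ∀ (y : Fin (d (H.tgt e)) → ℂ) (y' : Fin (d (H.tgt e')) → ℂ),
      (H.relations F χ e).mkQ y = τ e (PiTensorProduct.tprod ℂ fun j => x (H.src e j)) →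
      (H.relations F χ e').mkQ y' = τ e' (PiTensorProduct.tprod ℂ fun j => x (H.src e' j)) →
      (x (H.tgt e) : Fin (d (H.tgt e)) → ℂ) ⬝ᵥ y = (x (H.tgt e') : Fin (d (H.tgt e')) → ℂ) ⬝ᵥ y'

end bundle

end Hyperquiver

end SVB
end

/-!
Write `x` for the tuple of representatives of a point `χ`.  For a tensor `T` of a class and a
hyperedge `e` of this class, the contraction of `T(x_{s(e)})` with `x_{t(e)}` is the full contraction
of `T` with the vectors at all positions, so it does not depend on `e`.  This number is determined by
the component at `e` of a point of the fibre at `χ` if `e ∈ F` or if `x_{t(e)}` is isotropic, and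
then the equality of these numbers is a condition on the values of the sections
(`dotProduct_contract`, `fullContract_permute`).  There are no other conditions: given vectors `y e`
whose contractions with `x_{t(e)}` agree in each class, tensors with `T(x_{s(e)}) = y e` are written
down as sums of rank one tensors, which uses that the targets of distinct hyperedges of a class sit
at distinct positions (`exists_contract_eq`); and at a non-isotropic target of a hyperedge outside
`F` the representative of a class modulo `x_{t(e)}` can be chosen with any prescribed contraction.
Hence the values at `χ` are exactly the tuples with equal contractions for the set `α` of vertices
at which `χ` is isotropic (`mem_values_iff`).

The strata are therefore the irreducible components of the loci where the vertices in `α` are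
isotropic, for all `α` such that these loci are nonempty.  They are products of projective spaces,
of quadrics of positive dimension, and of single points of the projective line.  They are
irreducible because any two points are joined by a rational curve, a line or a conic in each factor
(`exists_isotropic_arc`, `isIrreducible_polynomial_curve`), and smooth by the Jacobian criterion.
A point of a stratum which is isotropic at a further vertex lies in a smaller stratum
(`isotropic_subset_of_notMem_smaller`).  Over a stratum the equations between the contractions have
constant rank, since the contraction with a nonzero vector `x` is a nonzero form on the ambient
space, and for isotropic `x` on its quotient by `x`; solving them for one coordinate each gives the
subbundles (`isSubbundle_equalContractions`).
-/

noncomputable section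

namespace SVB

variable {n : ℕ} {d : Fin n → ℕ}

/-! ### Representatives and multihomogeneous equations -/

theorem IsMultiHom.eval_smul {P : CoordRing d} {m : Fin n → ℕ} (h : IsMultiHom P m)
    (a : Fin n → ℂ) (x : ∀ i, Fin (d i) → ℂ) :
    MvPolynomial.eval (fun v => (a v.1 • x v.1) v.2) P =
      (∏ i, a i ^ m i) * MvPolynomial.eval (fun v => x v.1 v.2) P := by
  rw [MvPolynomial.eval_eq', MvPolynomial.eval_eq', Finset.mul_sum]
  refine Finset.sum_congr rfl fun e he => ?_
  have hw := h (MvPolynomial.mem_support_iff.mp he)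
  have hm : ∀ i, m i = ∑ k, e ⟨i, k⟩ := by
    intro i
    rw [← hw, Finsupp.weight_apply, Finsupp.sum_fintype _ _ (by simp), Finset.sum_apply,
      Fintype.sum_sigma, Finset.sum_eq_single i]
    · simp
    · intro j _ hj
      simp [Pi.single_eq_of_ne hj.symm]
    · simp
  simp only [Pi.smul_apply, smul_eq_mul, mul_pow, Finset.prod_mul_distrib]
  have ha : ∏ v : (Σ i, Fin (d i)), a v.1 ^ e v = ∏ i, a i ^ m i := by
    rw [Fintype.prod_sigma]
    exact Finset.prod_congr rfl fun i _ => by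
      rw [hm]
      exact Finset.prod_pow_eq_pow_sum Finset.univ (fun k => e ⟨i, k⟩) (a i)
  rw [ha, mul_left_comm]

/-- The point of `∏ i, ℙ(ℂ^(d i))` with given homogeneous coordinates. -/
def MultiProj.mk (x : ∀ i, Fin (d i) → ℂ) (hx : ∀ i, x i ≠ 0) : MultiProj d :=
  fun i => Projectivization.mk ℂ (x i) (hx i)

theorem MultiProj.mk_vec (χ : MultiProj d) : MultiProj.mk χ.vec χ.vec_ne_zero = χ :=
  funext fun i => Projectivization.mk_rep (χ i)

theorem IsMultiHom.evalAt_mk_eq_zero {P : CoordRing d} {m : Fin n → ℕ} (h : IsMultiHom P m)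
    (x : ∀ i, Fin (d i) → ℂ) (hx : ∀ i, x i ≠ 0) :
    evalAt (MultiProj.mk x hx) P = 0 ↔ MvPolynomial.eval (fun v => x v.1 v.2) P = 0 := by
  choose a ha using fun i => Projectivization.exists_smul_eq_mk_rep ℂ (x i) (hx i)
  have : evalAt (MultiProj.mk x hx) P =
      (∏ i, (a i : ℂ) ^ m i) * MvPolynomial.eval (fun v => x v.1 v.2) P := by
    rw [← h.eval_smul]
    unfold evalAt MultiProj.vec MultiProj.mk
    congr 2
    funext v
    rw [← ha]
    rfl
  rw [this, mul_eq_zero, or_iff_right]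
  exact Finset.prod_ne_zero_iff.mpr fun i _ => pow_ne_zero _ (a i).ne_zero

theorem IsMultiHom.isClosed {P : CoordRing d} {m : Fin n → ℕ} (h : IsMultiHom P m) :
    IsClosed {χ : MultiProj d | evalAt χ P = 0} := by
  rw [← isOpen_compl_iff]
  exact TopologicalSpace.isOpen_generateFrom_of_mem ⟨P, m, h, rfl⟩

/-! ### Irreducibility by means of rational curves -/

/-- The points of a polynomial curve form an irreducible set: it is the continuous image of a
cofinite set of parameters with the cofinite topology. -/
theorem isIrreducible_polynomial_curve (γ : ∀ i, Fin (d i) → Polynomial ℂ)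
    (t₀ : ℂ) (h₀ : ∀ i, (fun k => (γ i k).eval t₀) ≠ 0) :
    IsIrreducible {χ : MultiProj d | ∃ (t : ℂ) (ht : ∀ i, (fun k => (γ i k).eval t) ≠ 0),
      χ = MultiProj.mk (fun i k => (γ i k).eval t) ht} := by
  set T : Set ℂ := {t | ∀ i, (fun k => (γ i k).eval t) ≠ 0} with hT
  have hfin : Tᶜ.Finite := by
    have hk : ∀ i, ∃ k, (γ i k).eval t₀ ≠ 0 := fun i => Function.ne_iff.mp (h₀ i)
    choose k hk using hk
    refine (Set.finite_iUnion fun i => (Polynomial.rootSet_finite (γ i (k i)) ℂ)).subset ?_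
    intro t ht
    simp only [hT, Set.mem_compl_iff, Set.mem_ofPred_eq, not_forall, not_not] at ht
    obtain ⟨i, hi⟩ := ht
    refine Set.mem_iUnion.mpr ⟨i, ?_⟩
    rw [Polynomial.mem_rootSet]
    refine ⟨fun h => hk i (by simp [h]), ?_⟩
    simpa using congrFun hi (k i)
  have hinf : Infinite T := by
    have := hfin.infinite_compl
    rw [compl_compl] at this
    exact this.to_subtype
  have : Infinite (CofiniteTopology T) := CofiniteTopology.of.infinite_iff.mp hinf
  let f : T → MultiProj d := fun t => MultiProj.mk _ t.2
  have hf : Continuous fun t : CofiniteTopology T => f (CofiniteTopology.of.symm t) := by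
    refine continuous_generateFrom_iff.mpr ?_
    rintro _ ⟨P, m, hP, rfl⟩
    rw [CofiniteTopology.isOpen_iff]
    rintro ⟨t₁, ht₁⟩
    let p : Polynomial ℂ := MvPolynomial.aeval (fun v : Σ i, Fin (d i) => γ v.1 v.2) P
    have hp : ∀ t, p.eval t = MvPolynomial.eval (fun v => (γ v.1 v.2).eval t) P := by
      intro t
      have := MvPolynomial.comp_aeval_apply (R := ℂ) (fun v : Σ i, Fin (d i) => γ v.1 v.2)
        (Polynomial.aeval t : Polynomial ℂ →ₐ[ℂ] ℂ) P
      simpa [p, Polynomial.coe_aeval_eq_eval, MvPolynomial.aeval_eq_eval] using this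
    have hz : ∀ t : T, evalAt (f t) P = 0 ↔ p.eval t.1 = 0 := fun t => by
      rw [hp]; exact hP.evalAt_mk_eq_zero _ t.2
    have hp0 : p ≠ 0 := fun h => ht₁ ((hz _).mpr (by simp [h]))
    refine Set.Finite.subset (Set.Finite.preimage
      (CofiniteTopology.of.symm.injective.injOn (f := CofiniteTopology.of.symm))
      (Set.Finite.preimage Subtype.val_injective.injOn (Polynomial.rootSet_finite p ℂ))) ?_
    intro t ht
    have := (hz _).mp (not_not.mp ht)
    rw [Set.mem_preimage, Set.mem_preimage, Polynomial.mem_rootSet]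
    exact ⟨hp0, by simpa using this⟩
  have himg : {χ : MultiProj d | ∃ (t : ℂ) (ht : ∀ i, (fun k => (γ i k).eval t) ≠ 0),
      χ = MultiProj.mk (fun i k => (γ i k).eval t) ht} =
      (fun t : CofiniteTopology T => f (CofiniteTopology.of.symm t)) '' Set.univ := by
    ext χ
    constructor
    · rintro ⟨t, ht, rfl⟩
      exact ⟨CofiniteTopology.of ⟨t, ht⟩, trivial, rfl⟩
    · rintro ⟨t, -, rfl⟩
      exact ⟨_, (CofiniteTopology.of.symm t).2, rfl⟩
  rw [himg]
  exact (IrreducibleSpace.isIrreducible_univ _).image _ hf.continuousOn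

/-- A nonempty set is irreducible if any two of its points lie in an irreducible subset. -/
theorem isIrreducible_of_joined {X : Type*} [TopologicalSpace X] {Y : Set X} (hY : Y.Nonempty)
    (h : ∀ a ∈ Y, ∀ b ∈ Y, ∃ Z, IsIrreducible Z ∧ Z ⊆ Y ∧ a ∈ Z ∧ b ∈ Z) : IsIrreducible Y := by
  refine ⟨hY, ?_⟩
  rintro u v hu hv ⟨a, haY, hau⟩ ⟨b, hbY, hbv⟩
  obtain ⟨Z, hZ, hZY, ha, hb⟩ := h a haY b hbY
  obtain ⟨x, hx, hx'⟩ := hZ.2 u v hu hv ⟨a, ha, hau⟩ ⟨b, hb, hbv⟩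
  exact ⟨x, hZY hx, hx'⟩

/-! ### Components of the isotropic quadric in one projective space -/

/-- An equation of an irreducible component of the cone `x ⬝ x = 0` in `ℂ^m`, for `2 ≤ m`.  For
`m = 2` the quadric is a pair of points, whose components `x₀ = ε i x₁` are indexed by the sign `ε`;
for `3 ≤ m` the quadric is irreducible, and the sign plays no role. -/
def isotropicForm {m : ℕ} (ε : ℤˣ) (x : Fin m → ℂ) : ℂ :=
  if h : m = 2 then x ⟨0, by omega⟩ - ((ε : ℤ) : ℂ) * Complex.I * x ⟨1, by omega⟩ else x ⬝ᵥ x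

theorem sign_sq (ε : ℤˣ) : ((ε : ℤ) : ℂ) ^ 2 = 1 := by
  rcases Int.units_eq_one_or ε with rfl | rfl <;> norm_num

theorem dotProduct_self_of_isotropicForm {m : ℕ} {ε : ℤˣ} {x : Fin m → ℂ}
    (h : isotropicForm ε x = 0) : x ⬝ᵥ x = 0 := by
  unfold isotropicForm at h
  split_ifs at h with hm
  · subst hm
    change x 0 - _ * x 1 = 0 at h
    rw [dotProduct, Fin.sum_univ_two]
    linear_combination (x 0 + ((ε : ℤ) : ℂ) * Complex.I * x 1) * h +
      (x 1) ^ 2 * Complex.I ^ 2 * sign_sq ε + (x 1) ^ 2 * Complex.I_sq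
  · exact h

theorem exists_isotropicForm_eq_zero {m : ℕ} {x : Fin m → ℂ} (h : x ⬝ᵥ x = 0) :
    ∃ ε, isotropicForm ε x = 0 := by
  unfold isotropicForm
  split_ifs with hm
  · subst hm
    rw [dotProduct, Fin.sum_univ_two] at h
    have : (x 0 - Complex.I * x 1) * (x 0 + Complex.I * x 1) = 0 := by
      linear_combination h - (x 1) ^ 2 * Complex.I_sq
    rcases mul_eq_zero.mp this with h | h
    · exact ⟨1, by simpa using h⟩
    · exact ⟨-1, by simpa using h⟩
  · exact ⟨1, h⟩

theorem isotropicForm_congr {m : ℕ} (hm : m ≠ 2) (ε ε' : ℤˣ) (x : Fin m → ℂ) :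
    isotropicForm ε x = isotropicForm ε' x := by
  simp [isotropicForm, hm]

theorem sign_eq_of_isotropicForm {m : ℕ} (hm : m = 2) {ε ε' : ℤˣ} {x : Fin m → ℂ} (hx : x ≠ 0)
    (h : isotropicForm ε x = 0) (h' : isotropicForm ε' x = 0) : ε = ε' := by
  by_contra hne
  apply hx
  subst hm
  simp only [isotropicForm, dif_pos] at h h'
  change x 0 - _ * x 1 = 0 at h
  change x 0 - _ * x 1 = 0 at h'
  have h1 : x 1 = 0 := by
    rcases Int.units_eq_one_or ε with rfl | rfl <;> rcases Int.units_eq_one_or ε' with rfl | rfl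
    · exact absurd rfl hne
    · have : 2 * Complex.I * x 1 = 0 := by push_cast at h h'; linear_combination h' - h
      simpa using this
    · have : 2 * Complex.I * x 1 = 0 := by push_cast at h h'; linear_combination h - h'
      simpa using this
    · exact absurd rfl hne
  funext k
  fin_cases k
  · simpa [h1] using h
  · exact h1

theorem exists_isotropicForm_point {m : ℕ} (hm : 2 ≤ m) (ε : ℤˣ) :
    ∃ x : Fin m → ℂ, x ≠ 0 ∧ isotropicForm ε x = 0 := by
  unfold isotropicForm
  split_ifs with h
  · subst h
    refine ⟨![((ε : ℤ) : ℂ) * Complex.I, 1], fun h => by simpa using congrFun h 1, ?_⟩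
    change _ - _ * (1 : ℂ) = 0
    simp
  · refine ⟨Pi.single ⟨0, by omega⟩ 1 + Pi.single ⟨1, by omega⟩ Complex.I,
      fun h => ?_, ?_⟩
    · have := congrFun h (⟨0, by omega⟩ : Fin m)
      simp at this
    · simp

theorem exists_dotProduct_self_ne_zero {m : ℕ} (hm : 1 ≤ m) :
    ∃ x : Fin m → ℂ, x ≠ 0 ∧ x ⬝ᵥ x ≠ 0 :=
  ⟨Pi.single ⟨0, by omega⟩ 1, fun h => by simpa using congrFun h ⟨0, by omega⟩, by simp⟩

/-- Two zeros `x`, `y` of `isotropicForm` are joined by a line or a conic of zeros.  If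
`x ⬝ y ≠ 0`, the control point `z` is orthogonal to `x` and `y`; it can be taken non-isotropic since
the orthogonal projection to `{x, y}^⊥` has trace `m - 2 ≠ 0`. -/
theorem exists_isotropic_arc {m : ℕ} {ε : ℤˣ} {x y : Fin m → ℂ}
    (hx : isotropicForm ε x = 0) (hy : isotropicForm ε y = 0) :
    ∃ z : Fin m → ℂ, ∀ t : ℂ,
      isotropicForm ε ((1 - t) ^ 2 • x + (t * (1 - t)) • z + t ^ 2 • y) = 0 := by
  have key : ∀ (t : ℂ) (z : Fin m → ℂ),
      ((1 - t) ^ 2 • x + (t * (1 - t)) • z + t ^ 2 • y) ⬝ᵥ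
        ((1 - t) ^ 2 • x + (t * (1 - t)) • z + t ^ 2 • y) =
      (1 - t) ^ 4 * (x ⬝ᵥ x) + t ^ 4 * (y ⬝ᵥ y) +
        (t * (1 - t)) ^ 2 * (z ⬝ᵥ z + 2 * (x ⬝ᵥ y)) +
        2 * (t * (1 - t) ^ 3) * (x ⬝ᵥ z) + 2 * (t ^ 3 * (1 - t)) * (y ⬝ᵥ z) := by
    intro t z
    simp only [add_dotProduct, dotProduct_add, smul_dotProduct, dotProduct_smul, smul_eq_mul]
    rw [dotProduct_comm z x, dotProduct_comm y x, dotProduct_comm z y]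
    ring
  have hx0 := dotProduct_self_of_isotropicForm hx
  have hy0 := dotProduct_self_of_isotropicForm hy
  by_cases h2 : m = 2
  · refine ⟨x + y, fun t => ?_⟩
    simp only [isotropicForm, dif_pos h2] at hx hy ⊢
    simp only [Pi.add_apply, Pi.smul_apply, smul_eq_mul]
    linear_combination (1 - t) * hx + t * hy
  simp only [isotropicForm, dif_neg h2]
  by_cases hs : x ⬝ᵥ y = 0
  · refine ⟨x + y, fun t => ?_⟩
    rw [key]
    simp only [add_dotProduct, dotProduct_add, hx0, hy0, hs, dotProduct_comm y x]
    ring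
  set s := x ⬝ᵥ y with hsdef
  have hk : ∃ k, 1 - 2 * (x k * y k) / s ≠ 0 := by
    by_contra! hk
    have h := Finset.sum_eq_zero fun k (_ : k ∈ Finset.univ) => hk k
    rw [Finset.sum_sub_distrib, ← Finset.sum_div, ← Finset.mul_sum] at h
    change _ - 2 * (x ⬝ᵥ y) / s = 0 at h
    rw [← hsdef, mul_div_assoc, div_self hs] at h
    simp only [Finset.sum_const, Finset.card_univ, Fintype.card_fin, nsmul_eq_mul, mul_one] at h
    have h' : (m : ℂ) = (2 : ℕ) := by push_cast; linear_combination h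
    exact h2 (by exact_mod_cast h')
  obtain ⟨k, hk⟩ := hk
  set u : Fin m → ℂ := Pi.single k 1 - (y k / s) • x - (x k / s) • y with hu
  have hxu : x ⬝ᵥ u = 0 := by
    simp only [hu, dotProduct_sub, dotProduct_smul, hx0, ← hsdef, smul_eq_mul,
      dotProduct_single_one]
    field_simp
    ring
  have hyu : y ⬝ᵥ u = 0 := by
    simp only [hu, dotProduct_sub, dotProduct_smul, hy0, dotProduct_comm y x, ← hsdef, smul_eq_mul,
      dotProduct_single_one]
    field_simp
    ring
  have huu : u ⬝ᵥ u = 1 - 2 * (x k * y k) / s := by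
    have : u ⬝ᵥ u = u ⬝ᵥ Pi.single k 1 := by
      conv_lhs => rw [hu, dotProduct_sub, dotProduct_sub, dotProduct_smul, dotProduct_smul, ← hu,
        dotProduct_comm u x, hxu, dotProduct_comm u y, hyu]
      simp
    rw [this, dotProduct_single_one]
    simp [hu]
    ring
  obtain ⟨a, ha⟩ := IsAlgClosed.exists_pow_nat_eq (-2 * s / (u ⬝ᵥ u)) (n := 2) (by norm_num)
  rw [← huu] at hk
  refine ⟨a • u, fun t => ?_⟩
  rw [key]
  simp only [dotProduct_smul, smul_dotProduct, hxu, hyu, hx0, hy0, smul_eq_mul]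
  have : a * (a * (u ⬝ᵥ u)) = -2 * s := by
    rw [← mul_assoc, ← sq, ha, div_mul_cancel₀ _ hk]
  rw [this]
  ring

/-- The multihomogeneous polynomial `isotropicForm` in the coordinates of the `i`-th factor. -/
def isotropicPoly (d : Fin n → ℕ) (i : Fin n) (ε : ℤˣ) : CoordRing d :=
  if h : d i = 2 then MvPolynomial.X ⟨i, ⟨0, by omega⟩⟩ -
    MvPolynomial.C (((ε : ℤ) : ℂ) * Complex.I) * MvPolynomial.X ⟨i, ⟨1, by omega⟩⟩
  else ∑ k, MvPolynomial.X ⟨i, k⟩ * MvPolynomial.X ⟨i, k⟩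

theorem isMultiHom_isotropicPoly (i : Fin n) (ε : ℤˣ) :
    ∃ m, IsMultiHom (isotropicPoly d i ε) m := by
  unfold isotropicPoly
  split_ifs with h
  · refine ⟨Pi.single i 1, (isMultiHom_X _ _).sub ?_⟩
    rw [← zero_add (Pi.single i 1)]
    exact (MvPolynomial.isWeightedHomogeneous_C _ _).mul (isMultiHom_X _ _)
  · exact ⟨_, MvPolynomial.IsWeightedHomogeneous.sum _ _ _
      fun k _ => (isMultiHom_X i k).mul (isMultiHom_X i k)⟩

theorem eval_isotropicPoly (i : Fin n) (ε : ℤˣ) (x : ∀ i, Fin (d i) → ℂ) :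
    MvPolynomial.eval (fun v : Σ i, Fin (d i) => x v.1 v.2) (isotropicPoly d i ε) =
      isotropicForm ε (x i) := by
  unfold isotropicPoly isotropicForm
  split_ifs <;> simp [dotProduct]

theorem pderiv_isotropicPoly_of_ne {i : Fin n} (ε : ℤˣ) {v : Σ i, Fin (d i)} (hv : v.1 ≠ i) :
    MvPolynomial.pderiv v (isotropicPoly d i ε) = 0 := by
  have hX : ∀ k, MvPolynomial.pderiv v (MvPolynomial.X ⟨i, k⟩ : CoordRing d) = 0 := fun k =>
    MvPolynomial.pderiv_X_of_ne fun h => hv (congrArg Sigma.fst h).symm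
  unfold isotropicPoly
  split_ifs <;> simp [Derivation.leibniz, hX]

/-- The cone over a component of the isotropic quadric is smooth away from the origin. -/
theorem exists_pderiv_isotropicPoly_ne_zero (i : Fin n) (ε : ℤˣ) {x : ∀ i, Fin (d i) → ℂ}
    (hx : x i ≠ 0) : ∃ k, MvPolynomial.eval (fun v : Σ i, Fin (d i) => x v.1 v.2)
      (MvPolynomial.pderiv ⟨i, k⟩ (isotropicPoly d i ε)) ≠ 0 := by
  unfold isotropicPoly
  split_ifs with h
  · refine ⟨⟨0, by omega⟩, ?_⟩
    rw [map_sub, MvPolynomial.pderiv_X_self, MvPolynomial.pderiv_C_mul,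
      MvPolynomial.pderiv_X_of_ne (by simp)]
    simp
  · obtain ⟨k, hk⟩ := Function.ne_iff.mp hx
    refine ⟨k, ?_⟩
    rw [map_sum, Finset.sum_eq_single k]
    · rw [Derivation.leibniz, MvPolynomial.pderiv_X_self]
      simpa [← two_mul] using hk
    · intro l _ hl
      rw [Derivation.leibniz, MvPolynomial.pderiv_X_of_ne (by simpa using hl)]
      simp
    · simp

/-! ### Components of the isotropic loci -/

/-- The product of the components `isotropicForm (s i) x = 0` of the isotropic quadrics at the
vertices `i ∈ α` and of the full projective spaces at the other vertices.  The signs `s i` matter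
only for `i ∈ α` with `d i = 2`. -/
def stratum (d : Fin n → ℕ) (α : Set (Fin n)) (s : Fin n → ℤˣ) : Set (MultiProj d) :=
  {χ | ∀ i ∈ α, isotropicForm (s i) (χ.vec i) = 0}

section strata

variable {α β : Set (Fin n)} {s s' : Fin n → ℤˣ}

theorem evalAt_isotropicPoly (χ : MultiProj d) (i : Fin n) (ε : ℤˣ) :
    evalAt χ (isotropicPoly d i ε) = isotropicForm ε (χ.vec i) :=
  eval_isotropicPoly i ε χ.vec

theorem mk_mem_stratum {x : ∀ i, Fin (d i) → ℂ} {hx : ∀ i, x i ≠ 0} :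
    MultiProj.mk x hx ∈ stratum d α s ↔ ∀ i ∈ α, isotropicForm (s i) (x i) = 0 := by
  refine forall₂_congr fun i _ => ?_
  obtain ⟨m, hm⟩ := isMultiHom_isotropicPoly (d := d) i (s i)
  rw [← evalAt_isotropicPoly, hm.evalAt_mk_eq_zero, eval_isotropicPoly]

theorem MultiProj.vec_mk (x : ∀ i, Fin (d i) → ℂ) (hx : ∀ i, x i ≠ 0) (i : Fin n) :
    ∃ a : ℂ, a ≠ 0 ∧ (MultiProj.mk x hx).vec i = a • x i := by
  obtain ⟨a, ha⟩ := Projectivization.exists_smul_eq_mk_rep ℂ (x i) (hx i)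
  exact ⟨a, a.ne_zero, ha.symm⟩

theorem stratum_subset_isotropicLocus :
    stratum d α s ⊆ isotropicLocus d α :=
  fun _ hχ i hi => dotProduct_self_of_isotropicForm (hχ i hi)

theorem isClosed_zeroLocus_isotropicForm (i : Fin n) (ε : ℤˣ) :
    IsClosed {χ : MultiProj d | isotropicForm ε (χ.vec i) = 0} := by
  obtain ⟨m, hm⟩ := isMultiHom_isotropicPoly (d := d) i ε
  simpa only [evalAt_isotropicPoly] using hm.isClosed

theorem isClosed_stratum : IsClosed (stratum d α s) := by
  have : stratum d α s = ⋂ i ∈ α, {χ : MultiProj d | isotropicForm (s i) (χ.vec i) = 0} := by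
    ext χ; simp [stratum]
  rw [this]
  exact isClosed_biInter fun i _ => isClosed_zeroLocus_isotropicForm i (s i)

theorem stratum_nonempty (hd : ∀ i, 1 ≤ d i) (hα : ∀ i ∈ α, 2 ≤ d i) :
    (stratum d α s).Nonempty := by
  have h : ∀ i, ∃ x : Fin (d i) → ℂ, x ≠ 0 ∧ (i ∈ α → isotropicForm (s i) x = 0) := by
    intro i
    by_cases hi : i ∈ α
    · obtain ⟨x, hx, hx'⟩ := exists_isotropicForm_point (hα i hi) (s i)
      exact ⟨x, hx, fun _ => hx'⟩
    · obtain ⟨x, hx, -⟩ := exists_dotProduct_self_ne_zero (hd i)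
      exact ⟨x, hx, fun h => absurd h hi⟩
  choose x hx hx' using h
  exact ⟨MultiProj.mk x hx, mk_mem_stratum.mpr hx'⟩

theorem isIrreducible_stratum (hd : ∀ i, 1 ≤ d i) (hα : ∀ i ∈ α, 2 ≤ d i) :
    IsIrreducible (stratum d α s) := by
  refine isIrreducible_of_joined (stratum_nonempty hd hα) fun χ hχ ψ hψ => ?_
  have h : ∀ i, ∃ z : Fin (d i) → ℂ, i ∈ α → ∀ t : ℂ, isotropicForm (s i)
      ((1 - t) ^ 2 • χ.vec i + (t * (1 - t)) • z + t ^ 2 • ψ.vec i) = 0 := by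
    intro i
    by_cases hi : i ∈ α
    · obtain ⟨z, hz⟩ := exists_isotropic_arc (hχ i hi) (hψ i hi)
      exact ⟨z, fun _ => hz⟩
    · exact ⟨0, fun h => absurd h hi⟩
  choose z hz using h
  -- `γ` joins `χ` at `t = 0` to `ψ` at `t = 1`; it may leave the locus of nonzero vectors between
  let γ : ∀ i, Fin (d i) → Polynomial ℂ := fun i k =>
    (1 - Polynomial.X) ^ 2 * Polynomial.C (χ.vec i k) +
      Polynomial.X * (1 - Polynomial.X) * Polynomial.C (z i k) +
      Polynomial.X ^ 2 * Polynomial.C (ψ.vec i k)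
  have hγ : ∀ t i, (fun k => (γ i k).eval t) =
      (1 - t) ^ 2 • χ.vec i + (t * (1 - t)) • z i + t ^ 2 • ψ.vec i := by
    intro t i
    funext k
    simp [γ]
    ring
  have h0 : ∀ i, (fun k => (γ i k).eval 0) = χ.vec i := fun i => by rw [hγ]; simp
  have h1 : ∀ i, (fun k => (γ i k).eval 1) = ψ.vec i := fun i => by rw [hγ]; simp
  refine ⟨_, isIrreducible_polynomial_curve γ 0 fun i => by rw [h0]; exact χ.vec_ne_zero i,
    ?_, ⟨0, fun i => by rw [h0]; exact χ.vec_ne_zero i, ?_⟩,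
    ⟨1, fun i => by rw [h1]; exact ψ.vec_ne_zero i, ?_⟩⟩
  · rintro _ ⟨t, ht, rfl⟩
    refine mk_mem_stratum.mpr fun i hi => ?_
    rw [hγ]
    exact hz i hi t
  · conv_lhs => rw [← χ.mk_vec]
    congr 1
    exact funext fun i => (h0 i).symm
  · conv_lhs => rw [← ψ.mk_vec]
    congr 1
    exact funext fun i => (h1 i).symm

theorem isSmooth_stratum : IsSmooth (stratum d α s) := by
  classical
  intro χ _
  let e := Fintype.equivFin α
  refine ⟨Set.univ, Fintype.card α, fun a => isotropicPoly d (e.symm a) (s (e.symm a)), isOpen_univ,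
    trivial, fun a => isMultiHom_isotropicPoly _ _, fun ψ _ => ?_, ?_⟩
  · simp only [evalAt_isotropicPoly]
    refine ⟨fun h a => h _ (e.symm a).2, fun h i hi => ?_⟩
    have := h (e ⟨i, hi⟩)
    rwa [e.symm_apply_apply] at this
  · rw [Fintype.linearIndependent_iff]
    intro g hg a
    obtain ⟨k, hk⟩ := exists_pderiv_isotropicPoly_ne_zero (e.symm a : Fin n) (s (e.symm a))
      (χ.vec_ne_zero _)
    have h := congrFun hg ⟨e.symm a, k⟩
    rw [Finset.sum_apply, Finset.sum_eq_single a] at h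
    · exact (mul_eq_zero.mp h).resolve_right hk
    · intro b _ hb
      have : ((e.symm a : α) : Fin n) ≠ e.symm b := fun h =>
        hb (e.symm.injective (Subtype.ext h)).symm
      rw [Pi.smul_apply, pderiv_isotropicPoly_of_ne _ this]
      simp [evalAt]
    · simp

/-- Away from the vertices in `α`, a component of a point of the stratum can be chosen
non-isotropic. -/
theorem exists_mem_stratum_not_isotropic (hd : ∀ i, 1 ≤ d i) {χ : MultiProj d}
    (hχ : χ ∈ stratum d α s) {i : Fin n} (hi : i ∉ α) :
    ∃ ψ ∈ stratum d α s, ψ.vec i ⬝ᵥ ψ.vec i ≠ 0 := by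
  obtain ⟨x, hx, hxx⟩ := exists_dotProduct_self_ne_zero (hd i)
  have hne : ∀ j, Function.update χ.vec i x j ≠ 0 := by
    intro j
    by_cases hj : j = i
    · subst hj; simpa using hx
    · simpa [hj] using χ.vec_ne_zero j
  refine ⟨MultiProj.mk _ hne, mk_mem_stratum.mpr fun j hj => ?_, ?_⟩
  · have : j ≠ i := fun h => hi (h ▸ hj)
    rw [Function.update_of_ne this]
    exact hχ j hj
  · obtain ⟨a, ha, h⟩ := MultiProj.vec_mk _ hne i
    rw [h, Function.update_self, smul_dotProduct, dotProduct_smul]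
    exact smul_ne_zero ha (smul_ne_zero ha hxx)

theorem subset_of_stratum_subset_isotropicLocus (hd : ∀ i, 1 ≤ d i) {χ : MultiProj d}
    (hχ : χ ∈ stratum d α s) (h : stratum d α s ⊆ isotropicLocus d β) : β ⊆ α := by
  intro i hi
  by_contra hi'
  obtain ⟨ψ, hψ, hne⟩ := exists_mem_stratum_not_isotropic hd hχ hi'
  exact hne (h hψ i hi)

theorem isSmoothIrredProper_stratum (hd : ∀ i, 1 ≤ d i) (hα : ∀ i ∈ α, 2 ≤ d i)
    (hne : α.Nonempty) : IsSmoothIrredProper (stratum d α s) where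
  closed := isClosed_stratum
  irreducible := isIrreducible_stratum hd hα
  smooth := isSmooth_stratum
  proper := by
    intro h
    obtain ⟨χ, hχ⟩ := stratum_nonempty (s := s) hd hα
    have h' : stratum d ∅ s ⊆ isotropicLocus d α := by
      refine fun ψ _ => stratum_subset_isotropicLocus (s := s) ?_
      rw [h]
      trivial
    obtain ⟨i, hi⟩ := hne
    exact subset_of_stratum_subset_isotropicLocus hd (χ := χ) (fun _ h => absurd h id) h' hi

/-- The strata are irreducible components of the isotropic loci. -/
theorem maximal_stratum (hd : ∀ i, 1 ≤ d i) (hα : ∀ i ∈ α, 2 ≤ d i) :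
    Maximal (fun S => IsIrreducible S ∧ S ⊆ isotropicLocus d α) (stratum d α s) := by
  refine ⟨⟨isIrreducible_stratum hd hα, stratum_subset_isotropicLocus⟩, ?_⟩
  rintro S ⟨hS, hSα⟩ hle
  obtain ⟨χ, hχ⟩ := stratum_nonempty (s := s) hd hα
  intro ψ hψ i hi
  by_cases h2 : d i = 2
  · have hcov : S ⊆ {χ : MultiProj d | isotropicForm (s i) (χ.vec i) = 0} ∪
        {χ : MultiProj d | isotropicForm (-s i) (χ.vec i) = 0} := by
      intro φ hφ
      obtain ⟨ε, hε⟩ := exists_isotropicForm_eq_zero (hSα hφ i hi)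
      rcases Int.units_eq_one_or ε with rfl | rfl <;>
        rcases Int.units_eq_one_or (s i) with h | h <;> simp [h, hε]
    rcases isPreirreducible_iff_isClosed_union_isClosed.mp hS.2 _ _
      (isClosed_zeroLocus_isotropicForm i _) (isClosed_zeroLocus_isotropicForm i _) hcov with h | h
    · exact h hψ
    · have := sign_eq_of_isotropicForm h2 (χ.vec_ne_zero i) (hχ i hi) (h (hle hχ))
      exact absurd this.symm (units_ne_neg_self (s i)).symm
  · obtain ⟨ε, hε⟩ := exists_isotropicForm_eq_zero (hSα hψ i hi)
    rw [isotropicForm_congr h2 _ ε, hε]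

end strata

/-! ### Regular functions and subbundles given by linear equations -/

section regular

variable {S S' : Set (MultiProj d)} {f g : MultiProj d → ℂ}

theorem IsRegularOn.mono (hf : IsRegularOn S f) (h : S' ⊆ S) : IsRegularOn S' f := by
  intro χ hχ
  obtain ⟨P, Q, m, hP, hQ, h0, hfg⟩ := hf χ (h hχ)
  exact ⟨P, Q, m, hP, hQ, h0, fun ψ hψ => hfg ψ (h hψ)⟩

theorem IsRegularOn.congr (hf : IsRegularOn S f) (h : ∀ χ ∈ S, g χ = f χ) : IsRegularOn S g := by
  intro χ hχ
  obtain ⟨P, Q, m, hP, hQ, h0, hfg⟩ := hf χ hχ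
  exact ⟨P, Q, m, hP, hQ, h0, fun ψ hψ hne => (h ψ hψ).trans (hfg ψ hψ hne)⟩

theorem IsRegularOn.add (hf : IsRegularOn S f) (hg : IsRegularOn S g) :
    IsRegularOn S (fun χ => f χ + g χ) :=
  (hf.sub ((IsRegularOn.const 0).sub hg)).congr fun _ _ => by ring

theorem IsRegularOn.sum {ι : Type*} (s : Finset ι) {f : ι → MultiProj d → ℂ}
    (hf : ∀ i ∈ s, IsRegularOn S (f i)) : IsRegularOn S (fun χ => ∑ i ∈ s, f i χ) := by
  classical
  induction s using Finset.induction_on with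
  | empty => simpa using IsRegularOn.const (S := S) 0
  | insert a s ha ih =>
    simp only [Finset.sum_insert ha]
    exact (hf a (by simp)).add (ih fun i hi => hf i (by simp [hi]))

end regular

/-- Fibres which are given, in local coordinates, by linear equations with regular coefficients in
reduced echelon form, with a constant set `N` of pivots, form a subbundle. -/
theorem VBundle.isSubbundle_of_echelon (B : VBundle d) {Y : Set (MultiProj d)}
    {W : ∀ χ, Submodule ℂ (B.Fib χ)}
    (h : ∀ χ ∈ Y, ∃ (c : B.Chart) (U : Set (MultiProj d)) (N : Set (B.Coord c))
      (a : B.Coord c → B.Coord c → MultiProj d → ℂ),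
      IsOpen U ∧ χ ∈ U ∧ U ⊆ B.dom c ∧ (∀ p l, IsRegularOn (Y ∩ U) (a p l)) ∧
      (∀ p, ∀ l ∈ N, ∀ ψ ∈ Y ∩ U, a p l ψ = 0) ∧
      ∀ ψ ∈ Y ∩ U, ∀ w : B.Fib ψ,
        w ∈ W ψ ↔ ∀ p ∈ N, B.triv c ψ w p = ∑ l, a p l ψ * B.triv c ψ w l) :
    B.IsSubbundle Y W := by
  classical
  intro χ hχ
  obtain ⟨c, U, N, a, hU, hχU, hUc, hreg, hN, hW⟩ := h χ hχ
  let e := Fintype.equivFin {l : B.Coord c // l ∉ N}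
  let v : Fin (Fintype.card {l : B.Coord c // l ∉ N}) → MultiProj d → B.Coord c → ℂ :=
    fun j ψ k => if k ∈ N then a k (e.symm j) ψ else if k = e.symm j then 1 else 0
  have hs : ∀ j ψ, ∃ w : B.Fib ψ, ψ ∈ B.dom c → B.triv c ψ w = v j ψ := by
    intro j ψ
    by_cases hψ : ψ ∈ B.dom c
    · obtain ⟨w, hw⟩ := (B.triv_bijective c ψ hψ).2 (v j ψ)
      exact ⟨w, fun _ => hw⟩
    · exact ⟨0, fun h => absurd h hψ⟩
  choose s hs using hs
  -- the frame `s` takes the value `1` at one free coordinate and `0` at the others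
  have hcoord : ∀ ψ ∈ Y ∩ U, ∀ g : Fin (Fintype.card {l : B.Coord c // l ∉ N}) → ℂ,
      ∀ (k : B.Coord c) (hk : k ∉ N), B.triv c ψ (∑ j, g j • s j ψ) k = g (e ⟨k, hk⟩) := by
    intro ψ hψ g k hk
    rw [map_sum, Finset.sum_apply, Finset.sum_eq_single (e ⟨k, hk⟩)]
    · simp [hs _ ψ (hUc hψ.2), v, hk]
    · intro j _ hj
      have : k ≠ e.symm j := by
        rintro rfl
        simp at hj
      simp [hs _ ψ (hUc hψ.2), v, hk, this]
    · simp
  refine ⟨U, _, s, hU, hχU, fun j c' k => ?_, fun ψ hψ => ⟨?_, ?_⟩⟩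
  · obtain ⟨g, hg, hg'⟩ := B.transition c c'
    have hv : ∀ l, IsRegularOn (Y ∩ U) fun ψ => v j ψ l := by
      intro l
      simp only [v]
      split_ifs
      · exact hreg _ _
      · exact IsRegularOn.const _
      · exact IsRegularOn.const _
    refine (IsRegularOn.sum Finset.univ fun l _ =>
      ((hg k l).mono ?_).mul ((hv l).mono Set.inter_subset_left)).congr fun ψ hψ => ?_
    · exact fun ψ hψ => ⟨hUc hψ.1.2, hψ.2⟩
    · rw [hg' ψ ⟨hUc hψ.1.2, hψ.2⟩, hs j ψ (hUc hψ.1.2)]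
  · rw [Fintype.linearIndependent_iff]
    intro g hg j
    have := hcoord ψ hψ g _ (e.symm j).2
    rw [hg, map_zero] at this
    simpa using this.symm
  · apply le_antisymm
    · rw [Submodule.span_le]
      rintro _ ⟨j, rfl⟩
      refine (hW ψ hψ _).mpr fun p hp => ?_
      rw [hs j ψ (hUc hψ.2), Finset.sum_eq_single (e.symm j : B.Coord c)]
      · simp [v, hp, (e.symm j).2]
      · intro l _ hl
        by_cases hlN : l ∈ N
        · rw [hN p l hlN ψ hψ, zero_mul]
        · simp [v, hl, hlN]
      · simp
    · intro w hw
      have : w = ∑ j, B.triv c ψ w (e.symm j) • s j ψ := by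
        apply (B.triv_bijective c ψ (hUc hψ.2)).1
        funext k
        by_cases hk : k ∈ N
        · rw [(hW ψ hψ w).mp hw k hk, map_sum, Finset.sum_apply]
          have : ∀ j, B.triv c ψ (B.triv c ψ w (e.symm j) • s j ψ) k =
              a k (e.symm j) ψ * B.triv c ψ w (e.symm j) := by
            intro j
            simp [hs j ψ (hUc hψ.2), v, hk, mul_comm]
          rw [Finset.sum_congr rfl fun j _ => this j,
            e.symm.sum_comp (fun l : {l // l ∉ N} => a k l ψ * B.triv c ψ w l)]
          rw [← Fintype.sum_subtype_add_sum_subtype (fun l => l ∉ N), add_eq_left]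
          refine Finset.sum_eq_zero fun l _ => ?_
          rw [hN k l (not_not.mp l.2) ψ hψ, zero_mul]
        · rw [hcoord ψ hψ _ k hk]
          simp
      rw [this]
      exact Submodule.sum_mem _ fun j _ => Submodule.smul_mem _ _ (Submodule.subset_span ⟨j, rfl⟩)

namespace Hyperquiver

variable {q : ℕ} {H : Hyperquiver n q} {F : Finset (Fin q)}

/-! ### Contractions of tensors -/

theorem prod_snoc (e : Fin q) (i : ∀ j, Fin (d (H.src e j))) (l : Fin (d (H.tgt e)))
    (g : ∀ j, Fin (d (H.vert e j)) → ℂ) :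
    ∏ j, g j (Fin.snoc (α := fun j => Fin (d (H.vert e j))) i l j) =
      (∏ j : Fin (H.index e), g j.castSucc (i j)) * g (Fin.last _) l := by
  rw [Fin.prod_univ_castSucc]
  refine congrArg₂ _ (Finset.prod_congr rfl fun j _ => congrArg (g j.castSucc) ?_)
    (congrArg (g (Fin.last _)) ?_)
  · exact Fin.snoc_castSucc (α := fun j => Fin (d (H.vert e j))) l i j
  · exact Fin.snoc_last (α := fun j => Fin (d (H.vert e j))) l i

/-- The contraction of a tensor at `e` with the vectors at all the vertices of `e`, including the
target. -/
def fullContract (e : Fin q) (T : H.Tensor d e) (x : ∀ i, Fin (d i) → ℂ) : ℂ :=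
  ∑ i, T i * ∏ j, x (H.vert e j) (i j)

theorem dotProduct_contract (e : Fin q) (T : H.Tensor d e) (x : ∀ i, Fin (d i) → ℂ) :
    x (H.tgt e) ⬝ᵥ H.contract e T (fun j => x (H.src e j)) = fullContract e T x := by
  rw [fullContract, ← (Fin.snocEquiv fun j => Fin (d (H.vert e j))).sum_comp,
    Fintype.sum_prod_type, dotProduct]
  refine Finset.sum_congr rfl fun l _ => ?_
  rw [contract_apply, Finset.mul_sum]
  refine Finset.sum_congr rfl fun i _ => ?_
  rw [← mul_assoc, mul_comm _ (T _), mul_assoc, mul_comm (x _ l)]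
  exact congrArg (T _ * ·) (prod_snoc e i l fun j k => x (H.vert e j) k).symm

theorem fullContract_permute (P : H.Partition) (e : Fin q) (T : H.Tensor d (P.rep (P.cls e)))
    (x : ∀ i, Fin (d i) → ℂ) :
    fullContract e (P.permute e T) x = fullContract (P.rep (P.cls e)) T x := by
  have hx : ∀ {a b : Fin n} (h : a = b) (k : Fin (d a)),
      x a k = x b (Fin.cast (congrArg d h) k) := by rintro a _ rfl k; rfl
  let φ : (∀ j : Fin (H.index e + 1), Fin (d (H.vert e j))) ≃
      (∀ j : Fin (H.index (P.rep (P.cls e)) + 1), Fin (d (H.vert (P.rep (P.cls e)) j))) :=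
    { toFun := fun i j => Fin.cast
        (congrArg d (by rw [← P.vert_perm e, Equiv.apply_symm_apply])) (i ((P.perm e).symm j))
      invFun := fun i j => Fin.cast (congrArg d (P.vert_perm e j)) (i (P.perm e j))
      left_inv := fun i => by
        funext j
        apply Fin.ext
        simp only [Fin.val_cast]
        rw [Equiv.symm_apply_apply]
      right_inv := fun i => by
        funext j
        apply Fin.ext
        simp only [Fin.val_cast]
        rw [Equiv.apply_symm_apply] }
  refine Fintype.sum_equiv φ _ _ fun i => ?_
  congr 1
  refine Fintype.prod_equiv (P.perm e) _ _ fun j => ?_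
  rw [hx (P.vert_perm e j).symm]
  congr 1
  apply Fin.ext
  simp only [φ, Equiv.coe_fn_mk, Fin.val_cast]
  rw [Equiv.symm_apply_apply]

/-- The rank one tensor at `e` with factors `w j`.  Vectors are given as functions on `ℕ`, of which
only the values on the index ranges are used, so that factors can be moved between positions. -/
def rankOne (d : Fin n → ℕ) (e : Fin q) (w : Fin (H.index e + 1) → ℕ → ℂ) : H.Tensor d e :=
  fun i => ∏ j, w j (i j)

theorem permute_rankOne (P : H.Partition) (e : Fin q)
    (w : Fin (H.index (P.rep (P.cls e)) + 1) → ℕ → ℂ) :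
    P.permute e (rankOne d (P.rep (P.cls e)) w) = rankOne d e (fun j => w (P.perm e j)) := by
  funext i
  simp only [Partition.permute, rankOne, Fin.val_cast]
  exact (Fintype.prod_equiv (P.perm e) _ _ fun j => by rw [Equiv.symm_apply_apply]).symm

theorem contract_rankOne (e : Fin q) (w : Fin (H.index e + 1) → ℕ → ℂ)
    (x : ∀ j, Fin (d (H.src e j)) → ℂ) (l : Fin (d (H.tgt e))) :
    H.contract e (rankOne d e w) x l =
      (∏ j : Fin (H.index e), ∑ k : Fin (d (H.src e j)), w j.castSucc k * x j k) *
        w (Fin.last _) l := by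
  rw [contract_apply, Finset.prod_univ_sum, Finset.sum_mul, Fintype.piFinset_univ]
  refine Finset.sum_congr rfl fun i _ => ?_
  rw [rankOne, prod_snoc e i l fun j k => w j k, Finset.prod_mul_distrib]
  ring

/-! ### Contraction of the values of a section with the vector at the target -/

/-- In the chart `c`, the contraction of a vector in the fibre at the hyperedge `e` with the vector
at its target, in terms of the local coordinates `z`. -/
def chartPairing (c : ∀ i : Fin n, Fin (d i)) (χ : MultiProj d) (e : Fin q)
    (z : H.FibCoord F c → ℂ) : ℂ :=
  ∑ k : {k : Fin (d (H.tgt e)) // e ∈ F ∨ k ≠ c (H.tgt e)},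
    (unitVec c χ (H.tgt e) : Fin (d (H.tgt e)) → ℂ) k * z ⟨e, k⟩

theorem unitVec_self {c : ∀ i : Fin n, Fin (d i)} {χ : MultiProj d} (hχ : χ ∈ chartDom c)
    (i : Fin n) : (unitVec c χ i : Fin (d i) → ℂ) (c i) = 1 :=
  inv_mul_cancel₀ (hχ i)

theorem unitVec_dotProduct_self {c : ∀ i : Fin n, Fin (d i)} {χ : MultiProj d} {i : Fin n}
    (h : χ.vec i ⬝ᵥ χ.vec i = 0) :
    (unitVec c χ i : Fin (d i) → ℂ) ⬝ᵥ (unitVec c χ i : Fin (d i) → ℂ) = 0 := by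
  change ((χ.vec i (c i))⁻¹ • χ.vec i) ⬝ᵥ ((χ.vec i (c i))⁻¹ • χ.vec i) = 0
  rw [smul_dotProduct, dotProduct_smul, h, smul_zero, smul_zero]

theorem coordForm_eq_sub {c : ∀ i : Fin n, Fin (d i)} {χ : MultiProj d} (hχ : χ ∈ chartDom c)
    {e : Fin q} (he : e ∉ F) (k : Fin (d (H.tgt e))) (y : Fin (d (H.tgt e)) → ℂ) :
    H.coordForm F c χ e k y =
      y k - (unitVec c χ (H.tgt e) : Fin (d (H.tgt e)) → ℂ) k * y (c (H.tgt e)) := by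
  have hc := hχ (H.tgt e)
  simp only [coordForm, if_neg he, LinearMap.smul_apply, LinearMap.sub_apply,
    LinearMap.proj_apply, smul_eq_mul, unitVec_apply]
  field_simp

theorem dotProduct_eq_chartPairing {c : ∀ i : Fin n, Fin (d i)} {χ : MultiProj d}
    (hχ : χ ∈ chartDom c) {e : Fin q} (he : e ∈ F ∨ χ.vec (H.tgt e) ⬝ᵥ χ.vec (H.tgt e) = 0)
    (φ : ∀ e, H.EdgeFib F χ e) (y : Fin (d (H.tgt e)) → ℂ)
    (hy : (H.relations F χ e).mkQ y =
      φ e (PiTensorProduct.tprod ℂ fun j => unitVec c χ (H.src e j))) :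
    (unitVec c χ (H.tgt e) : Fin (d (H.tgt e)) → ℂ) ⬝ᵥ y =
      chartPairing c χ e (H.trivMap F c χ φ) := by
  classical
  set x : Fin (d (H.tgt e)) → ℂ := (unitVec c χ (H.tgt e) : Fin (d (H.tgt e)) → ℂ) with hx
  have h1 : chartPairing c χ e (H.trivMap F c χ φ) =
      ∑ k : {k : Fin (d (H.tgt e)) // e ∈ F ∨ k ≠ c (H.tgt e)},
        x k * H.coordForm F c χ e k y :=
    Finset.sum_congr rfl fun k _ => by rw [trivMap_apply c χ φ ⟨e, k⟩ y hy.symm]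
  have h2 : ∑ k : {k : Fin (d (H.tgt e)) // e ∈ F ∨ k ≠ c (H.tgt e)},
        x k * H.coordForm F c χ e k y = ∑ k, x k * H.coordForm F c χ e k y := by
    rw [← Fintype.sum_subtype_add_sum_subtype (fun k => e ∈ F ∨ k ≠ c (H.tgt e))
      (fun k => x k * H.coordForm F c χ e k y), left_eq_add]
    refine Finset.sum_eq_zero fun k _ => ?_
    obtain ⟨k, hk⟩ := k
    rw [not_or, not_not] at hk
    obtain ⟨heF, rfl⟩ := hk
    rw [coordForm_eq_sub hχ heF, unitVec_self hχ]
    simp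
  rw [h1, h2]
  by_cases heF : e ∈ F
  · simp [coordForm, heF, dotProduct]
  · have h0 : x ⬝ᵥ x = 0 := unitVec_dotProduct_self (he.resolve_left heF)
    have : ∀ k, x k * H.coordForm F c χ e k y = x k * y k - x k * x k * y (c (H.tgt e)) := by
      intro k
      rw [coordForm_eq_sub hχ heF]
      ring
    rw [Finset.sum_congr rfl fun k _ => this k, Finset.sum_sub_distrib, ← Finset.sum_mul]
    change x ⬝ᵥ y = x ⬝ᵥ y - x ⬝ᵥ x * _
    rw [h0, zero_mul, sub_zero]

theorem dotProduct_eq_of_mkQ_eq {χ : MultiProj d} {e : Fin q}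
    (he : e ∈ F ∨ χ.vec (H.tgt e) ⬝ᵥ χ.vec (H.tgt e) = 0) (x : χ.line (H.tgt e))
    {y y' : Fin (d (H.tgt e)) → ℂ}
    (h : (H.relations F χ e).mkQ y = (H.relations F χ e).mkQ y') :
    (x : Fin (d (H.tgt e)) → ℂ) ⬝ᵥ y = (x : Fin (d (H.tgt e)) → ℂ) ⬝ᵥ y' := by
  rw [← sub_eq_zero, ← map_sub, Submodule.mkQ_apply, Submodule.Quotient.mk_eq_zero] at h
  rw [← sub_eq_zero, ← dotProduct_sub]
  by_cases heF : e ∈ F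
  · rw [relations, if_pos heF, Submodule.mem_bot] at h
    rw [h, dotProduct_zero]
  · rw [relations, if_neg heF, χ.line_eq, Submodule.mem_span_singleton] at h
    obtain ⟨a, ha⟩ := h
    obtain ⟨b, hb⟩ := Submodule.mem_span_singleton.mp ((χ.line_eq (H.tgt e)).le x.2)
    rw [← ha, ← hb, smul_dotProduct, dotProduct_smul, he.resolve_left heF, smul_zero, smul_zero]

/-- The product of the scalars at all the vertices of a hyperedge depends only on its class. -/
theorem Partition.prod_vert (P : H.Partition) (a : Fin n → ℂ) (e : Fin q) :
    ∏ j, a (H.vert e j) = ∏ j, a (H.vert (P.rep (P.cls e)) j) :=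
  Fintype.prod_equiv (P.perm e) _ _ fun j => by rw [P.vert_perm]

/-- It suffices to compare contractions for the representatives normalized in an affine chart,
since rescaling the representatives multiplies the contractions in one class by the same factor. -/
theorem equalContractions_iff (P : H.Partition) {α : Set (Fin n)} {c : ∀ i : Fin n, Fin (d i)}
    {χ : MultiProj d} (hχ : χ ∈ chartDom c) (hα : χ ∈ isotropicLocus d α)
    (τ : (H.singularVectorBundle F d).Fib χ) :
    EqualContractions F P α χ τ ↔ ∀ e e' : Fin q, P.cls e = P.cls e' →
      (e ∈ F ∨ H.tgt e ∈ α) → (e' ∈ F ∨ H.tgt e' ∈ α) →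
      chartPairing c χ e (H.trivMap F c χ τ) = chartPairing c χ e' (H.trivMap F c χ τ) := by
  have hiso : ∀ {e : Fin q}, (e ∈ F ∨ H.tgt e ∈ α) →
      e ∈ F ∨ χ.vec (H.tgt e) ⬝ᵥ χ.vec (H.tgt e) = 0 := fun he => he.imp_right (hα _)
  have hrep : ∀ e, ∃ y, (H.relations F χ e).mkQ y =
      τ e (PiTensorProduct.tprod ℂ fun j => unitVec c χ (H.src e j)) :=
    fun e => (H.relations F χ e).mkQ_surjective _
  have hscale : ∀ {e : Fin q}, (e ∈ F ∨ H.tgt e ∈ α) → ∀ (x : ∀ i, χ.line i)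
      (y : Fin (d (H.tgt e)) → ℂ),
      (H.relations F χ e).mkQ y = τ e (PiTensorProduct.tprod ℂ fun j => x (H.src e j)) →
      (x (H.tgt e) : Fin (d (H.tgt e)) → ℂ) ⬝ᵥ y =
        (∏ j, (x (H.vert e j) : Fin (d (H.vert e j)) → ℂ) (c (H.vert e j))) *
          chartPairing c χ e (H.trivMap F c χ τ) := by
    intro e he x y hy
    obtain ⟨y₀, hy₀⟩ := hrep e
    rw [map_tprod hχ, ← hy₀, ← map_smul] at hy
    rw [dotProduct_eq_of_mkQ_eq (hiso he) _ hy, dotProduct_smul, Fin.prod_univ_castSucc,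
      ← dotProduct_eq_chartPairing hχ (hiso he) τ y₀ hy₀, mul_assoc, smul_eq_mul]
    congr 1
    conv_lhs => rw [line_smul hχ (H.tgt e) (x (H.tgt e))]
    rw [Submodule.coe_smul, smul_dotProduct, smul_eq_mul]
    rfl
  constructor
  · intro h e e' hee he he'
    obtain ⟨y, hy⟩ := hrep e
    obtain ⟨y', hy'⟩ := hrep e'
    have hne : ∀ i, unitVec c χ i ≠ 0 := by
      intro i h0
      have := unitVec_self hχ i
      simp [h0] at this
    have := h e e' hee he he' (unitVec c χ) hne y y' hy hy'
    rwa [dotProduct_eq_chartPairing hχ (hiso he) τ y hy,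
      dotProduct_eq_chartPairing hχ (hiso he') τ y' hy'] at this
  · intro h e e' hee he he' x _ y y' hy hy'
    rw [hscale he x y hy, hscale he' x y' hy', h e e' hee he he',
      P.prod_vert (fun i => (x i : Fin (d i) → ℂ) (c i)) e,
      P.prod_vert (fun i => (x i : Fin (d i) → ℂ) (c i)) e', hee]

theorem EqualContractions.mono {P : H.Partition} {α β : Set (Fin n)} {χ : MultiProj d}
    {τ : (H.singularVectorBundle F d).Fib χ} (h : EqualContractions F P α χ τ) (hβ : β ⊆ α) :
    EqualContractions F P β χ τ :=
  fun e e' hee he he' => h e e' hee (he.imp_right (@hβ _)) (he'.imp_right (@hβ _))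

variable (F) in
/-- The fibres of the bundles of tuples with equal contractions.  The span is taken only to have a
subspace for every `χ`; over the isotropic locus of `α` it adds nothing. -/
def equalContractionsSubmodule (P : H.Partition) (α : Set (Fin n)) (χ : MultiProj d) :
    Submodule ℂ ((H.singularVectorBundle F d).Fib χ) :=
  Submodule.span ℂ {τ | EqualContractions F P α χ τ}

theorem mem_equalContractionsSubmodule {P : H.Partition} {α : Set (Fin n)} {χ : MultiProj d}
    (hα : χ ∈ isotropicLocus d α) {τ : (H.singularVectorBundle F d).Fib χ} :
    τ ∈ equalContractionsSubmodule F P α χ ↔ EqualContractions F P α χ τ := by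
  refine ⟨fun h => ?_, fun h => Submodule.subset_span h⟩
  obtain ⟨c, hc⟩ := chartDom_cover χ
  have hadd : ∀ (e : Fin q) (τ τ' : ∀ e, H.EdgeFib F χ e),
      chartPairing c χ e (H.trivMap F c χ (τ + τ')) =
        chartPairing c χ e (H.trivMap F c χ τ) + chartPairing c χ e (H.trivMap F c χ τ') := by
    intro e τ τ'
    simp [chartPairing, mul_add, Finset.sum_add_distrib]
  have hsmul : ∀ (e : Fin q) (a : ℂ) (τ : ∀ e, H.EdgeFib F χ e),
      chartPairing c χ e (H.trivMap F c χ (a • τ)) =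
        a * chartPairing c χ e (H.trivMap F c χ τ) := by
    intro e a τ
    simp [chartPairing, Finset.mul_sum, mul_left_comm]
  have hzero : ∀ (e : Fin q),
      chartPairing c χ e (H.trivMap F c χ (0 : ∀ e, H.EdgeFib F χ e)) = 0 := by
    intro e
    simp [chartPairing]
  induction h using Submodule.span_induction with
  | mem τ hτ => exact hτ
  | zero =>
    exact (equalContractions_iff P hc hα _).mpr fun e e' _ _ _ =>
      (hzero e).trans (hzero e').symm
  | add τ τ' _ _ h h' =>
    rw [equalContractions_iff P hc hα] at h h' ⊢
    intro e e' hee he he'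
    exact (hadd e τ τ').trans ((congrArg₂ _ (h e e' hee he he') (h' e e' hee he he')).trans
      (hadd e' τ τ').symm)
  | smul a τ _ h =>
    rw [equalContractions_iff P hc hα] at h ⊢
    intro e e' hee he he'
    exact (hsmul e a τ).trans ((congrArg (a * ·) (h e e' hee he he')).trans (hsmul e' a τ).symm)

/-! ### The values of the sections -/

/-- The contraction at `e`, as a linear map in the tensor at the representative of the class. -/
def contractPermute (P : H.Partition) (e : Fin q) (x : ∀ j, Fin (d (H.src e j)) → ℂ) :
    H.Tensor d (P.rep (P.cls e)) →ₗ[ℂ] (Fin (d (H.tgt e)) → ℂ) where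
  toFun T := H.contract e (P.permute e T) x
  map_add' T T' := by
    ext l
    simp [contract_apply, Partition.permute, add_mul, Finset.sum_add_distrib]
  map_smul' a T := by
    ext l
    simp [contract_apply, Partition.permute, Finset.mul_sum, mul_assoc]

theorem Partition.vert_eq (P : H.Partition) {e e' : Fin q} (h : P.cls e = P.cls e')
    {j : Fin (H.index e + 1)} {j' : Fin (H.index e' + 1)}
    (hj : (P.perm e j : ℕ) = P.perm e' j') : H.vert e j = H.vert e' j' := by
  have key : ∀ {r r' : Fin P.M} (_ : r = r') (p : Fin (H.index (P.rep r) + 1))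
      (p' : Fin (H.index (P.rep r') + 1)), (p : ℕ) = p' →
      H.vert (P.rep r) p = H.vert (P.rep r') p' := by
    rintro r _ rfl p p' hp
    rw [Fin.ext hp]
  exact (P.vert_perm e j).symm.trans ((key h _ _ hj).trans (P.vert_perm e' j'))

/-- The target of one hyperedge corresponds to a source of any other hyperedge of its class. -/
theorem Partition.exists_src_position (P : H.Partition) {e e' : Fin q} (h : P.cls e = P.cls e')
    (hne : e ≠ e') :
    ∃ j : Fin (H.index e), (P.perm e j.castSucc : ℕ) = P.perm e' (Fin.last _) ∧
      H.src e j = H.tgt e' := by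
  have hlt : (P.perm e' (Fin.last _) : ℕ) < H.index (P.rep (P.cls e)) + 1 := by
    rw [h]; exact (P.perm e' (Fin.last _)).2
  obtain ⟨j, hj⟩ := (P.perm e).surjective ⟨_, hlt⟩
  have hj' : (P.perm e j : ℕ) = P.perm e' (Fin.last _) := by rw [hj]
  induction j using Fin.lastCases with
  | last => exact absurd (P.perm_last_inj e e' h hj') hne
  | cast j => exact ⟨j, hj', P.vert_eq h hj'⟩

/-- Tensors with prescribed contractions `y e` at all hyperedges exist as soon as, in each class,
the contractions of `y e` with the vectors at the targets agree.  With vectors `ξ` dual to `x`, one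
takes `C ⨂ ξ`, corrected by tensors which are `y e - C ξ` at the target of `e` and `ξ` elsewhere. -/
theorem exists_contract_eq (P : H.Partition) (c : ∀ i : Fin n, Fin (d i))
    (x : ∀ i, Fin (d i) → ℂ) (hx : ∀ i, x i (c i) = 1) (C : Fin P.M → ℂ)
    (y : ∀ e, Fin (d (H.tgt e)) → ℂ) (hy : ∀ e, x (H.tgt e) ⬝ᵥ y e = C (P.cls e)) :
    ∃ T : ∀ r, H.Tensor d (P.rep r), ∀ e,
      H.contract e (P.permute e (T (P.cls e))) (fun j => x (H.src e j)) = y e := by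
  let ξ : Fin n → ℕ → ℂ := fun v k => if k = c v then 1 else 0
  have hξ : ∀ v, ∑ k : Fin (d v), ξ v k * x v k = 1 := by
    intro v
    rw [Finset.sum_eq_single (c v)]
    · simp [ξ, hx]
    · intro k _ hk
      simp [ξ, Fin.val_inj, hk]
    · simp
  let η : Fin q → ℕ → ℂ := fun e k =>
    if h : k < d (H.tgt e) then y e ⟨k, h⟩ - C (P.cls e) * ξ (H.tgt e) k else 0
  have hη : ∀ e (k : Fin (d (H.tgt e))), η e k = y e k - C (P.cls e) * ξ (H.tgt e) k := by
    intro e k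
    simp [η]
  have hη0 : ∀ e, ∑ k : Fin (d (H.tgt e)), η e k * x (H.tgt e) k = 0 := by
    intro e
    have : ∀ k : Fin (d (H.tgt e)), η e k * x (H.tgt e) k =
        x (H.tgt e) k * y e k - C (P.cls e) * (ξ (H.tgt e) k * x (H.tgt e) k) := by
      intro k; rw [hη]; ring
    rw [Finset.sum_congr rfl fun k _ => this k, Finset.sum_sub_distrib, ← Finset.mul_sum, hξ,
      mul_one, sub_eq_zero]
    exact hy e
  let w : ∀ (_ : Fin q) (r : Fin P.M), Fin (H.index (P.rep r) + 1) → ℕ → ℂ :=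
    fun e r p k => if (p : ℕ) = P.perm e (Fin.last _) then η e k else ξ (H.vert (P.rep r) p) k
  refine ⟨fun r => C r • rankOne d (P.rep r) (fun p => ξ (H.vert (P.rep r) p)) +
    ∑ e, if P.cls e = r then rankOne d (P.rep r) (w e r) else 0, fun e => ?_⟩
  -- the contractions at `e` of the three kinds of summands of the tensor
  have h1 : contractPermute P e (fun j => x (H.src e j))
      (rankOne d (P.rep (P.cls e)) (fun p => ξ (H.vert (P.rep (P.cls e)) p))) =
      fun l : Fin (d (H.tgt e)) => ξ (H.tgt e) l := by
    funext l
    change H.contract e _ _ l = _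
    rw [permute_rankOne, contract_rankOne]
    simp only [P.vert_perm]
    rw [Finset.prod_eq_one, one_mul]
    · rfl
    · exact fun j _ => hξ (H.src e j)
  have h2 : contractPermute P e (fun j => x (H.src e j))
      (rankOne d (P.rep (P.cls e)) (w e (P.cls e))) =
      fun l => y e l - C (P.cls e) * ξ (H.tgt e) l := by
    funext l
    change H.contract e _ _ l = _
    rw [permute_rankOne, contract_rankOne, Finset.prod_eq_one, one_mul, ← hη]
    · simp [w]
    · intro j _
      have hne : (P.perm e j.castSucc : ℕ) ≠ P.perm e (Fin.last _) := fun h =>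
        (Fin.castSucc_lt_last j).ne ((P.perm e).injective (Fin.ext h))
      simp only [w, if_neg hne, P.vert_perm]
      exact hξ (H.src e j)
  have h3 : ∀ e', e' ≠ e → P.cls e' = P.cls e → contractPermute P e (fun j => x (H.src e j))
      (rankOne d (P.rep (P.cls e)) (w e' (P.cls e))) = 0 := by
    intro e' hne hcls
    funext l
    change H.contract e _ _ l = _
    obtain ⟨j, hj, hsrc⟩ := P.exists_src_position hcls.symm hne.symm
    rw [permute_rankOne, contract_rankOne, Finset.prod_eq_zero (Finset.mem_univ j), zero_mul]
    · rfl
    · -- the factor `η e'` meets the vector at the target of `e'`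
      simp only [w, if_pos hj]
      have key : ∀ {v v' : Fin n} (_ : v = v') (f : ℕ → ℂ),
          ∑ k : Fin (d v), f k * x v k = ∑ k : Fin (d v'), f k * x v' k := by
        rintro v _ rfl f; rfl
      rw [key hsrc, hη0]
  change contractPermute P e _ _ = _
  rw [map_add, map_smul, h1, map_sum, Finset.sum_eq_single e]
  · rw [if_pos rfl, h2]
    funext l
    simp
  · intro e' _ hne
    split_ifs with h
    · exact h3 e' hne h
    · exact map_zero _
  · simp

theorem sectionMap_tprod (P : H.Partition) (T : ∀ r, H.Tensor d (P.rep r))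
    (c : ∀ i : Fin n, Fin (d i)) (χ : MultiProj d) (e : Fin q) :
    (sectionMap F P d T χ : ∀ e, H.EdgeFib F χ e) e
      (PiTensorProduct.tprod ℂ fun j => unitVec c χ (H.src e j)) =
    (H.relations F χ e).mkQ (H.contract e (P.permute e (T (P.cls e)))
      (fun j => (unitVec c χ (H.src e j) : Fin (d (H.src e j)) → ℂ))) := by
  change (H.relations F χ e).mkQ (PiTensorProduct.lift _ _) = _
  rw [PiTensorProduct.lift.tprod]
  rfl

theorem fib_ext {c : ∀ i : Fin n, Fin (d i)} {χ : MultiProj d} (hχ : χ ∈ chartDom c)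
    {τ τ' : ∀ e, H.EdgeFib F χ e}
    (h : ∀ e, τ e (PiTensorProduct.tprod ℂ fun j => unitVec c χ (H.src e j)) =
      τ' e (PiTensorProduct.tprod ℂ fun j => unitVec c χ (H.src e j))) : τ = τ' := by
  funext e
  apply PiTensorProduct.ext
  apply MultilinearMap.ext
  intro v
  simp only [LinearMap.compMultilinearMap_apply]
  rw [map_tprod hχ, map_tprod hχ (τ' e), h]

/-- The values at `χ` of the sections in the image of `L_F` are cut out by the equality of
contractions at the hyperedges whose target is isotropic at `χ` or which lie in `F`. -/
theorem mem_values_iff (P : H.Partition) (χ : MultiProj d)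
    (τ : (H.singularVectorBundle F d).Fib χ) :
    τ ∈ (H.singularVectorBundle F d).values (LinearMap.range (sectionMap F P d)) χ ↔
      EqualContractions F P {i | χ.vec i ⬝ᵥ χ.vec i = 0} χ τ := by
  obtain ⟨c, hc⟩ := chartDom_cover χ
  rw [equalContractions_iff P hc (α := {i | χ.vec i ⬝ᵥ χ.vec i = 0}) fun i hi => hi]
  constructor
  · rintro ⟨_, ⟨T, rfl⟩, rfl⟩ e e' hee he he'
    have h : ∀ e : Fin q, (e ∈ F ∨ χ.vec (H.tgt e) ⬝ᵥ χ.vec (H.tgt e) = 0) →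
        chartPairing c χ e (H.trivMap F c χ (sectionMap F P d T χ)) =
        fullContract (P.rep (P.cls e)) (T (P.cls e))
          (fun i => (unitVec c χ i : Fin (d i) → ℂ)) := by
      intro e he
      rw [← fullContract_permute, ← dotProduct_contract]
      exact (dotProduct_eq_chartPairing hc he _ _ (sectionMap_tprod P T c χ e).symm).symm
    refine (h e he).trans (Eq.trans ?_ (h e' he').symm)
    exact congrArg (fun r => fullContract (P.rep r) (T r)
      (fun i => (unitVec c χ i : Fin (d i) → ℂ))) hee
  · intro h
    -- the hyperedges at which the contraction of `τ` is defined
    let J : Fin q → Prop := fun e => e ∈ F ∨ χ.vec (H.tgt e) ⬝ᵥ χ.vec (H.tgt e) = 0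
    have hC : ∀ r : Fin P.M, ∃ a : ℂ, ∀ e, P.cls e = r → J e →
        chartPairing c χ e (H.trivMap F c χ τ) = a := by
      intro r
      by_cases hr : ∃ e, P.cls e = r ∧ J e
      · obtain ⟨e₀, rfl, he₀⟩ := hr
        exact ⟨_, fun e hee he => h e e₀ hee he he₀⟩
      · exact ⟨0, fun e hee he => absurd ⟨e, hee, he⟩ hr⟩
    choose C hC using hC
    have hy : ∀ e, ∃ y : Fin (d (H.tgt e)) → ℂ, (H.relations F χ e).mkQ y =
        τ e (PiTensorProduct.tprod ℂ fun j => unitVec c χ (H.src e j)) ∧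
        (unitVec c χ (H.tgt e) : Fin (d (H.tgt e)) → ℂ) ⬝ᵥ y = C (P.cls e) := by
      intro e
      obtain ⟨y, hy⟩ := (H.relations F χ e).mkQ_surjective
        (τ e (PiTensorProduct.tprod ℂ fun j => unitVec c χ (H.src e j)))
      by_cases he : J e
      · exact ⟨y, hy, (dotProduct_eq_chartPairing hc he τ y hy).trans (hC _ e rfl he)⟩
      · obtain ⟨heF, hne⟩ := not_or.mp he
        -- the target is not isotropic, so a multiple of its vector adjusts the contraction
        set x : Fin (d (H.tgt e)) → ℂ := (unitVec c χ (H.tgt e) : Fin (d (H.tgt e)) → ℂ) with hx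
        have hxx : x ⬝ᵥ x ≠ 0 := by
          change ((χ.vec _ (c _))⁻¹ • χ.vec _) ⬝ᵥ ((χ.vec _ (c _))⁻¹ • χ.vec _) ≠ 0
          rw [smul_dotProduct, dotProduct_smul]
          exact smul_ne_zero (inv_ne_zero (hc _)) (smul_ne_zero (inv_ne_zero (hc _)) hne)
        refine ⟨y + ((C (P.cls e) - x ⬝ᵥ y) / (x ⬝ᵥ x)) • x, ?_, ?_⟩
        · rw [map_add, hy, add_eq_left, Submodule.mkQ_apply, Submodule.Quotient.mk_eq_zero,
            relations, if_neg heF]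
          exact Submodule.smul_mem _ _ (unitVec c χ (H.tgt e)).2
        · rw [dotProduct_add, dotProduct_smul, smul_eq_mul, div_mul_cancel₀ _ hxx]
          ring
    choose y hy hyC using hy
    obtain ⟨T, hT⟩ := exists_contract_eq P c (fun i => (unitVec c χ i : Fin (d i) → ℂ))
      (fun i => unitVec_self hc i) C y hyC
    refine ⟨_, ⟨T, rfl⟩, fib_ext hc fun e => ?_⟩
    exact (sectionMap_tprod P T c χ e).trans ((congrArg _ (hT e)).trans (hy e))

/-! ### Regularity of the sections and subbundles of equal contractions -/

theorem isRegularOn_unitVec {S : Set (MultiProj d)} {c : ∀ i : Fin n, Fin (d i)}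
    (hS : S ⊆ chartDom c) (i : Fin n) (k : Fin (d i)) :
    IsRegularOn S (fun χ => (unitVec c χ i : Fin (d i) → ℂ) k) :=
  (isRegularOn_ratio i k (c i) fun _ hχ => hS hχ i).congr fun χ _ => by
    rw [unitVec_apply, inv_mul_eq_div]

theorem isRegularSection_sectionMap (P : H.Partition) (T : ∀ r, H.Tensor d (P.rep r)) :
    (H.singularVectorBundle F d).IsRegularSection Set.univ (sectionMap F P d T) := by
  rintro (c : ∀ i, Fin (d i)) ⟨e, k, hk⟩
  set S : Set (MultiProj d) := Set.univ ∩ chartDom c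
  have hS : S ⊆ chartDom c := Set.inter_subset_right
  have hy : ∀ l, IsRegularOn S fun χ => H.contract e (P.permute e (T (P.cls e)))
      (fun j => (unitVec c χ (H.src e j) : Fin (d (H.src e j)) → ℂ)) l := by
    intro l
    simp only [contract_apply]
    exact IsRegularOn.sum _ fun i _ => (IsRegularOn.const _).mul
      (IsRegularOn.prod _ fun j _ => isRegularOn_unitVec hS _ _)
  have htriv : ∀ χ, H.trivMap F c χ (sectionMap F P d T χ) ⟨e, k, hk⟩ =
      H.coordForm F c χ e k (H.contract e (P.permute e (T (P.cls e)))
      (fun j => (unitVec c χ (H.src e j) : Fin (d (H.src e j)) → ℂ))) := fun χ =>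
    trivMap_apply c χ _ ⟨e, k, hk⟩ _ (sectionMap_tprod P T c χ e)
  by_cases he : e ∈ F
  · exact (hy k).congr fun χ _ => (htriv χ).trans (by simp [coordForm, he])
  · exact ((hy k).sub ((isRegularOn_unitVec hS (H.tgt e) k).mul (hy (c (H.tgt e))))).congr
      fun χ hχ => (htriv χ).trans (coordForm_eq_sub (hS hχ) he k _)

theorem sum_ite_eq_chartPairing (c : ∀ i : Fin n, Fin (d i)) (χ : MultiProj d) (e : Fin q)
    (z : H.FibCoord F c → ℂ) :
    ∑ l : H.FibCoord F c, (if l.1 = e then (1 : ℂ) else 0) *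
      ((unitVec c χ (H.tgt l.1) : Fin (d (H.tgt l.1)) → ℂ) l.2.1 * z l) =
      chartPairing c χ e z := by
  rw [Fintype.sum_sigma, Finset.sum_eq_single e]
  · simp [chartPairing]
  · intro f _ hf
    simp [hf]
  · simp

/-- Over a subset of the isotropic locus of `α`, the tuples with equal contractions form a
subbundle.  In each class one fixes a hyperedge `b e` whose contraction is defined; the equation
which compares the contractions at `e` and `b e` is solved for one coordinate of the component at
`e`.  At an isotropic target this coordinate must differ from the one normalized in the chart, and
it exists since an isotropic vector has at least two nonzero coordinates. -/
theorem isSubbundle_equalContractions (P : H.Partition) {α : Set (Fin n)} {Y : Set (MultiProj d)}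
    (hY : Y ⊆ isotropicLocus d α) :
    (H.singularVectorBundle F d).IsSubbundle Y (equalContractionsSubmodule F P α) := by
  classical
  refine VBundle.isSubbundle_of_echelon _ fun χ hχ => ?_
  obtain ⟨c, hc⟩ := chartDom_cover χ
  have hp : ∀ v, ∃ k : Fin (d v), χ.vec v k ≠ 0 ∧ (v ∈ α → k ≠ c v) := by
    intro v
    by_cases hv : v ∈ α
    · by_contra! hk
      have h0 := hY hχ v hv
      rw [dotProduct, Finset.sum_eq_single (c v)] at h0
      · exact hc v (mul_self_eq_zero.mp h0)
      · intro k _ hkc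
        by_cases hk0 : χ.vec v k = 0
        · rw [hk0, zero_mul]
        · exact absurd (hk k hk0).2 hkc
      · simp
    · exact ⟨c v, hc v, fun h => absurd h hv⟩
  choose p hpχ hpc using hp
  -- the hyperedges at which the contraction is defined over `Y`
  let J : Fin q → Prop := fun e => e ∈ F ∨ H.tgt e ∈ α
  have hb : ∀ r : Fin P.M, ∃ f, ∀ e, P.cls e = r → J e → J f ∧ P.cls f = r := by
    intro r
    by_cases hr : ∃ e, P.cls e = r ∧ J e
    · obtain ⟨e, he, heJ⟩ := hr
      exact ⟨e, fun _ _ _ => ⟨heJ, he⟩⟩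
    · exact ⟨P.rep r, fun e he heJ => absurd ⟨e, he, heJ⟩ hr⟩
  choose b₀ hb₀ using hb
  let b : Fin q → Fin q := fun e => b₀ (P.cls e)
  have hbJ : ∀ {e}, J e → J (b e) := fun {e} he => (hb₀ _ e rfl he).1
  have hbcls : ∀ {e}, J e → P.cls (b e) = P.cls e := fun {e} he => (hb₀ _ e rfl he).2
  have hbb : ∀ {e}, J e → b (b e) = b e := fun {e} he => congrArg b₀ (hbcls he)
  let piv : ∀ e, Fin (d (H.tgt e)) := fun e => if e ∈ F then c (H.tgt e) else p (H.tgt e)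
  let N : Set (H.FibCoord F c) := {k | J k.1 ∧ b k.1 ≠ k.1 ∧ k.2.1 = piv k.1}
  let u : ∀ (ψ : MultiProj d) (l : H.FibCoord F c), ℂ := fun ψ l =>
    (unitVec c ψ (H.tgt l.1) : Fin (d (H.tgt l.1)) → ℂ) l.2.1
  let a : H.FibCoord F c → H.FibCoord F c → MultiProj d → ℂ := fun k l ψ =>
    if k ∉ N ∨ l ∈ N then 0 else ((if l.1 = b k.1 then 1 else 0) - (if l.1 = k.1 then 1 else 0)) *
      (u ψ l * (ψ.vec (H.tgt k.1) (c (H.tgt k.1)) / ψ.vec (H.tgt k.1) k.2.1))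
  have hpivU : ∀ ψ ∈ chartDom c ∩ chartDom p, ∀ e, ψ.vec (H.tgt e) (piv e) ≠ 0 := by
    intro ψ hψ e
    simp only [piv]
    split_ifs
    · exact hψ.1 _
    · exact hψ.2 _
  refine ⟨c, chartDom c ∩ chartDom p, N, a, (isOpen_chartDom c).inter (isOpen_chartDom p),
    ⟨hc, hpχ⟩, Set.inter_subset_left, fun k l => ?_, fun k l hl ψ _ => if_pos (Or.inr hl), ?_⟩
  · simp only [a]
    split_ifs with h
    · exact IsRegularOn.const _
    all_goals
      obtain ⟨hk, -⟩ := not_or.mp h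
      refine (IsRegularOn.const _).mul ((isRegularOn_unitVec (fun ψ hψ => hψ.2.1) _ _).mul
        (isRegularOn_ratio _ _ _ fun ψ hψ => ?_))
      rw [(not_not.mp hk).2.2]
      exact hpivU ψ hψ.2 _
  · rintro ψ ⟨hψY, hψ⟩ τ
    rw [mem_equalContractionsSubmodule (hY hψY), equalContractions_iff P hψ.1 (hY hψY)]
    set z : H.FibCoord F c → ℂ := H.trivMap F c ψ τ with hz
    change _ ↔ ∀ k ∈ N, z k = ∑ l, a k l ψ * z l
    -- the equation for `z k` says that the contractions at `k.1` and at `b k.1` agree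
    have hsum : ∀ k ∈ N, ∑ l, a k l ψ * z l = z k +
        (chartPairing c ψ (b k.1) z - chartPairing c ψ k.1 z) * (u ψ k)⁻¹ := by
      intro k hk
      have hterm : ∀ l, a k l ψ * z l = (if l = k then z k else 0) +
          ((if l.1 = b k.1 then 1 else 0) * (u ψ l * z l) -
            (if l.1 = k.1 then 1 else 0) * (u ψ l * z l)) * (u ψ k)⁻¹ := by
        intro l
        have hu : (u ψ k)⁻¹ = ψ.vec (H.tgt k.1) (c (H.tgt k.1)) / ψ.vec (H.tgt k.1) k.2.1 := by
          simp only [u, unitVec_apply, mul_inv, inv_inv]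
          rfl
        have hu0 : u ψ k ≠ 0 := by
          simp only [u, unitVec_apply, hk.2.2]
          exact mul_ne_zero (inv_ne_zero (hψ.1 _)) (hpivU ψ hψ _)
        by_cases hl : l ∈ N
        · have h1 : l.1 ≠ b k.1 := by
            intro h
            apply hl.2.1
            rw [h, hbb hk.1]
          simp only [a, if_pos (Or.inr hl : k ∉ N ∨ l ∈ N), if_neg h1]
          by_cases h2 : l.1 = k.1
          · have : l = k := by
              obtain ⟨e, m, hm⟩ := l
              obtain ⟨e', m', hm'⟩ := k
              obtain rfl : e = e' := h2
              have : m = m' := hl.2.2.trans hk.2.2.symm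
              subst this
              rfl
            subst this
            simp only [if_true]
            field_simp
            ring
          · have : l ≠ k := fun h => h2 (congrArg Sigma.fst h)
            simp [h2, this]
        · have : l ≠ k := by
            rintro rfl
            exact hl hk
          have hkl : ¬(k ∉ N ∨ l ∈ N) := not_or.mpr ⟨not_not.mpr hk, hl⟩
          simp only [a, if_neg hkl, if_neg this, ← hu]
          ring
      rw [Finset.sum_congr rfl fun l _ => hterm l, Finset.sum_add_distrib, ← Finset.sum_mul,
        Finset.sum_sub_distrib, sum_ite_eq_chartPairing, sum_ite_eq_chartPairing,
        Finset.sum_ite_eq' Finset.univ k, if_pos (Finset.mem_univ k)]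
    constructor
    · intro h k hk
      rw [hsum k hk, h _ _ (hbcls hk.1) (hbJ hk.1) hk.1, sub_self, zero_mul, add_zero]
    · intro h
      have key : ∀ e, J e → chartPairing c ψ e z = chartPairing c ψ (b e) z := by
        intro e he
        by_cases hbe : b e = e
        · rw [hbe]
        · have hpive : e ∈ F ∨ piv e ≠ c (H.tgt e) := by
            by_cases heF : e ∈ F
            · exact Or.inl heF
            · refine Or.inr ?_
              simp only [piv, if_neg heF]
              exact hpc _ (he.resolve_left heF)
          have hk : (⟨e, piv e, hpive⟩ : H.FibCoord F c) ∈ N := ⟨he, hbe, rfl⟩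
          have h1 := h _ hk
          rw [hsum _ hk, left_eq_add, mul_eq_zero] at h1
          have hu0 : (u ψ ⟨e, piv e, hpive⟩)⁻¹ ≠ 0 := by
            simp only [u, unitVec_apply]
            exact inv_ne_zero (mul_ne_zero (inv_ne_zero (hψ.1 _)) (hpivU ψ hψ e))
          exact (sub_eq_zero.mp (h1.resolve_right hu0)).symm
      intro e e' hee he he'
      rw [key e he, key e' he']
      simp only [b, hee]

/-! ### The stratification -/

/-- The indices of the strata: sets `α` of vertices at which isotropic points exist, with a choice
of signs.  Different signs may give the same stratum. -/
abbrev StratumIndex (d : Fin n → ℕ) : Type :=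
  {α : Finset (Fin n) // α.Nonempty ∧ ∀ i ∈ α, 2 ≤ d i} × (Fin n → ℤˣ)

/-- The set of isotropic vertices of a stratum; `none` is the index of the whole space. -/
def stratumSet : Option (StratumIndex d) → Set (Fin n)
  | none => ∅
  | some i => (i.1.1 : Set (Fin n))

/-- The signs which select the components of the quadrics on the projective lines. -/
def stratumSign : Option (StratumIndex d) → Fin n → ℤˣ
  | none => 1
  | some i => i.2

theorem two_le_of_mem_stratumSet (i : Option (StratumIndex d)) : ∀ v ∈ stratumSet i, 2 ≤ d v := by
  cases i with
  | none => exact fun v hv => absurd hv id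
  | some i => exact i.1.2.2

theorem two_le_of_isotropic {χ : MultiProj d} (hd : ∀ i, 1 ≤ d i) {v : Fin n}
    (h : χ.vec v ⬝ᵥ χ.vec v = 0) : 2 ≤ d v := by
  by_contra hlt
  have h1 : d v = 1 := le_antisymm (by omega) (hd v)
  have : Subsingleton (Fin (d v)) := by rw [h1]; infer_instance
  obtain ⟨k, hk⟩ := Function.ne_iff.mp (χ.vec_ne_zero v)
  rw [dotProduct, Fintype.sum_subsingleton _ k] at h
  exact hk (mul_self_eq_zero.mp h)

/-- Outside the smaller strata, the isotropic vertices of a point of a stratum are those which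
define the stratum. -/
theorem isotropic_subset_of_notMem_smaller (hd : ∀ i, 1 ≤ d i) (i : Option (StratumIndex d))
    {χ : MultiProj d} (hχ : χ ∈ stratum d (stratumSet i) (stratumSign i))
    (h : ∀ j : StratumIndex d, stratum d (stratumSet (some j)) (stratumSign (some j)) ⊂
      stratum d (stratumSet i) (stratumSign i) →
      χ ∉ stratum d (stratumSet (some j)) (stratumSign (some j))) :
    {v | χ.vec v ⬝ᵥ χ.vec v = 0} ⊆ stratumSet i := by
  classical
  intro v hv
  by_contra hvi
  have hs : ∀ w, ∃ ε : ℤˣ, χ.vec w ⬝ᵥ χ.vec w = 0 →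
      isotropicForm ε (χ.vec w) = 0 ∧ (w ∈ stratumSet i → ε = stratumSign i w) := by
    intro w
    by_cases hw : w ∈ stratumSet i
    · exact ⟨_, fun _ => ⟨hχ w hw, fun _ => rfl⟩⟩
    · by_cases hw0 : χ.vec w ⬝ᵥ χ.vec w = 0
      · obtain ⟨ε, hε⟩ := exists_isotropicForm_eq_zero hw0
        exact ⟨ε, fun _ => ⟨hε, fun h => absurd h hw⟩⟩
      · exact ⟨1, fun h => absurd h hw0⟩
  choose s hs using hs
  -- the component through `χ` of the locus of all its isotropic vertices
  let j : StratumIndex d := ⟨⟨Finset.univ.filter fun w => χ.vec w ⬝ᵥ χ.vec w = 0,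
    ⟨v, by simpa using hv⟩, fun w hw => two_le_of_isotropic hd (by simpa using hw)⟩, s⟩
  have hj : ∀ w, w ∈ stratumSet (some j) ↔ χ.vec w ⬝ᵥ χ.vec w = 0 := by
    intro w
    simp [stratumSet, j]
  have hle : stratum d (stratumSet (some j)) (stratumSign (some j)) ⊆
      stratum d (stratumSet i) (stratumSign i) := by
    intro ψ hψ w hw
    have hw0 := dotProduct_self_of_isotropicForm (hχ w hw)
    rw [← (hs w hw0).2 hw]
    exact hψ w ((hj w).mpr hw0)
  refine h j ⟨hle, fun hge => hvi ?_⟩ fun w hw => (hs w ((hj w).mp hw)).1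
  exact subset_of_stratum_subset_isotropicLocus hd hχ
    (hge.trans stratum_subset_isotropicLocus) ((hj v).mpr hv)

/-- Without two hyperedges of `F` in one class, having equal contractions for `α = ∅` is no
condition. -/
theorem equalContractions_empty {P : H.Partition}
    (hF : ∀ e ∈ F, ∀ e' ∈ F, P.cls e = P.cls e' → e = e') (χ : MultiProj d)
    (τ : (H.singularVectorBundle F d).Fib χ) : EqualContractions F P ∅ χ τ := by
  intro e e' hee he he' x _ y y' hy hy'
  have heF : e ∈ F := he.resolve_right id
  obtain rfl := hF e heF e' (he'.resolve_right id) hee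
  exact dotProduct_eq_of_mkQ_eq (Or.inl heF) _ (hy.trans hy'.symm)

end Hyperquiver

end SVB

end

open SVB SVB.Hyperquiver in
theorem proposition5 {n q : ℕ} (H : SVB.Hyperquiver n q) (P : H.Partition) (d : Fin n → ℕ)
    (hd : ∀ i, 1 ≤ d i) (F : Finset (Fin q))
    (hX : (∃ i, 2 ≤ d i) ∨ ∀ e ∈ F, ∀ e' ∈ F, P.cls e = P.cls e' → e = e') :
    (H.singularVectorBundle F d).AlmostGenerates
      (LinearMap.range (SVB.Hyperquiver.sectionMap F P d)) ∧
    ∃ (k : ℕ) (Y : Fin (k + 1) → Set (SVB.MultiProj d))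
      (W : Fin (k + 1) → ∀ χ, Submodule ℂ ((H.singularVectorBundle F d).Fib χ)),
      (H.singularVectorBundle F d).IsStratification
        (LinearMap.range (SVB.Hyperquiver.sectionMap F P d)) k Y W ∧
      (∀ i, ∃ α : Set (Fin n),
        Maximal (fun S => IsIrreducible S ∧ S ⊆ SVB.isotropicLocus d α) (Y i) ∧
        ∀ χ ∈ Y i, ∀ τ, τ ∈ W i χ ↔ SVB.Hyperquiver.EqualContractions F P α χ τ) ∧
      ((∀ e ∈ F, ∀ e' ∈ F, P.cls e = P.cls e' → e = e') → ∀ χ, W 0 χ = ⊤) := by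
  classical
  -- `Fin (k + 1)` enumerates the strata, with the whole space as number `0`
  set Λ := LinearMap.range (sectionMap F P d) with hΛ
  let k := Fintype.card (StratumIndex d)
  let ι : Fin (k + 1) ≃ Option (StratumIndex d) :=
    (finSuccEquiv k).trans (Fintype.equivFin (StratumIndex d)).symm.optionCongr
  have hι0 : ι 0 = none := by simp [ι]
  let Y : Fin (k + 1) → Set (MultiProj d) := fun i =>
    stratum d (stratumSet (ι i)) (stratumSign (ι i))
  let W : Fin (k + 1) → ∀ χ, Submodule ℂ ((H.singularVectorBundle F d).Fib χ) := fun i =>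
    equalContractionsSubmodule F P (stratumSet (ι i))
  have hYiso : ∀ i, Y i ⊆ isotropicLocus d (stratumSet (ι i)) := fun i =>
    stratum_subset_isotropicLocus
  have hstrat : (H.singularVectorBundle F d).IsStratification Λ k Y W := by
    refine ⟨?_, ?_, ?_, ?_, ?_, ?_⟩
    · refine Set.eq_univ_of_forall fun χ v hv => ?_
      rw [hι0] at hv
      exact absurd hv id
    · intro i hi
      obtain ⟨j, hj⟩ := Option.ne_none_iff_exists'.mp fun h => hi (ι.injective (h.trans hι0.symm))
      refine isSmoothIrredProper_stratum hd (two_le_of_mem_stratumSet _) ?_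
      rw [hj]
      exact j.1.2.1
    · exact fun i => isSubbundle_equalContractions P (hYiso i)
    · intro i j hij χ hχ τ hτ
      exact (mem_equalContractionsSubmodule (hYiso j (hij hχ))).mpr
        (((mem_equalContractionsSubmodule (hYiso i hχ)).mp hτ).mono
          (subset_of_stratum_subset_isotropicLocus hd hχ (hij.trans (hYiso j))))
    · intro i χ hχ τ hτ
      exact (mem_equalContractionsSubmodule (hYiso i hχ)).mpr
        (((mem_values_iff P χ τ).mp hτ).mono fun v hv => hYiso i hχ v hv)
    · intro i χ hχ hmin
      ext τ
      have hsub := isotropic_subset_of_notMem_smaller hd (ι i) hχ fun j hj hχj => by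
        obtain ⟨m, hm⟩ := ι.surjective (some j)
        refine hmin m (fun h => ?_) ?_ ?_
        · rw [h, hι0] at hm
          exact absurd hm (by simp)
        · simpa only [Y, hm] using hj
        · simpa only [Y, hm] using hχj
      have heq : {v | χ.vec v ⬝ᵥ χ.vec v = 0} = stratumSet (ι i) :=
        Set.Subset.antisymm hsub fun v hv => hYiso i hχ v hv
      rw [mem_values_iff, heq]
      exact (mem_equalContractionsSubmodule (hYiso i hχ)).symm
  have hW0 : (∀ e ∈ F, ∀ e' ∈ F, P.cls e = P.cls e' → e = e') → ∀ χ, W 0 χ = ⊤ := by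
    intro hF χ
    refine eq_top_iff.mpr fun τ _ => Submodule.subset_span ?_
    rw [hι0]
    exact equalContractions_empty hF χ τ
  refine ⟨⟨?_, ?_⟩, k, Y, W, hstrat, fun i => ⟨stratumSet (ι i),
    maximal_stratum hd (two_le_of_mem_stratumSet _),
    fun χ hχ τ => mem_equalContractionsSubmodule (hYiso i hχ)⟩, hW0⟩
  · rintro _ ⟨T, rfl⟩
    exact isRegularSection_sectionMap P T
  · by_cases hd2 : ∃ i, 2 ≤ d i
    · obtain ⟨i, hi⟩ := hd2
      have : Nonempty (StratumIndex d) :=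
        ⟨⟨⟨{i}, by simp, by simpa using hi⟩, 1⟩⟩
      exact Or.inr ⟨k, Fintype.card_pos, Y, W, hstrat⟩
    · -- `X` is a point, so that no point lies in a proper stratum
      refine Or.inl fun χ => ?_
      have hk : ∀ j : Fin (k + 1), j ≠ 0 → False := by
        intro j hj
        obtain ⟨m, -⟩ := Option.ne_none_iff_exists'.mp
          fun h => hj (ι.injective (h.trans hι0.symm))
        obtain ⟨v, hv⟩ := m.1.2.1
        exact hd2 ⟨v, m.1.2.2 v hv⟩
      rw [← hW0 (hX.resolve_left hd2) χ]
      refine hstrat.values_eq 0 χ ?_ fun j hj => (hk j hj).elim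
      rw [hstrat.zero]
      trivial
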